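/- Let $p,q$ be integers, $q\neq 0$, and let $\mu=(\mu_1,\dots,\mu_d)$ be small real parameters, each of degree one (a detuning $\delta$ is counted among them). Let $F_\mu(x,y)$ be a real function that is $C^\infty$ jointly in $(\mu,x,y)$ for $\mu$ in an open neighbourhood $U$ of $0$, is $1$-periodic in $x$ and in $y$, and vanishes for $\mu=0$ (for instance $F_{\delta,\mu}=\delta+\mu f_\mu(x,y)$). For $k,l\in\mathbb Z$ and a multi-index $m\in\mathbb N^d$ let $$f_{k,l,m}=\int_0^1\!\!\int_0^1 \tfrac1{m!}\,\partial_\mu^m F_\mu(x,y)\big|_{\mu=0}\; e^{-2\pi i(kx+ly)}\,dy\,dx$$ be its Fourier-Taylor coefficients. Consider the forced phase-oscillator vector field on $\mathbb R^2$ (a lift of one on the two-torus) $$X=\big(\tfrac pq+F_\mu(x,y)\big)\partial_x+\partial_y = X_0+X_1+X_2+\cdots,\qquad X_0=\tfrac pq\partial_x+\partial_y,\qquad X_j=\sum_{k,l,\,|m|=j} f_{k,l,m}\,\mu^m e^{2\pi i(kx+ly)}\,\partial_x ,$$ where the series is the formal expansion of $X$ in $\mu$. Let $n\ge 0$. There are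 coefficients $\tilde f_{k,l,m}$ that are determined by the original coefficients $(f_{k,l,m})$ (through a map depending only on $d,n,p,q$) and there are $C^\infty$ vector fields $Y_j=g_j\,\partial_x$, $j=1,\dots,n$, with $g_j(\mu,x,y)=\sum_{|m|=j}\mu^m g_m(x,y)$ and $g_m$ real, smooth and $1$-periodic in $x$ and $y$, with the following properties. 1. The time-one map $\psi_j=\psi_j^\mu$ of the flow of $Y_j$ is smooth jointly in the parameters and the phase variables, is for each $\mu$ a diffeomorphism of $\mathbb R^2$ that commutes with integer translations, and is near the identity: $\psi_j^\mu=\mathrm{id}+\mathcal O(|\mu|^j)$ as $\mu\to0$, uniformly on $\mathbb R^2$. 2. For $\mu$ in a neighbourhood $V\subseteq U$ of $0$ the $n$ successive coordinate transformations $\psi_1,\dots,\psi_n$ take $X$ into $\tilde X=\psi_n^*\cdots\psi_1^*X$ with $$\tilde X=X_0+\tilde X_1+\cdots+\tilde X_n+R_\mu(x,y)\,\partial_x,\qquad \tilde X_j=\sum_{|m|=j}\ \sum_{pk+ql=0}\tilde f_{k,l,m}\,\mu^m e^{2\pi i(kx+ly)}\,\partial_x ,$$ where the Fourier series converge absolutely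 to real smooth functions that are $1$-periodic in $x$ and $y$, and where $R_\mu(x,y)$ is smooth in $(\mu,x,y)$, $1$-periodic in $x$ and $y$, and $R_\mu=\mathcal O(|\mu|^{n+1})$ uniformly on $\mathbb R^2$. So up to order $n$ the transformed vector field contains only resonant terms, those with $pk+ql=0$. 3. $\tilde X_1$ keeps the original coefficients: $\tilde f_{k,l,m}=f_{k,l,m}$ whenever $|m|=1$ and $pk+ql=0$. -/

import Mathlib

open scoped ContDiff

namespace ForcedOscillator

/-- The parameters `μ = (μ₁, …, μ_d)`; a detuning `δ` is one of them. Each has degree one. -/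
abbrev Param (d : ℕ) := Fin d → ℝ

/-- The phase space `ℝ²` with points `(x, y)`, the universal cover of the two-torus. -/
abbrev Plane := ℝ × ℝ

/-- Arrays `c k l m` of Fourier-Taylor coefficients: `k`, `l` are the Fourier indices in `x`, `y`,
and the multi-index `m` belongs to the parameters. -/
abbrev CoeffArray (d : ℕ) := ℤ → ℤ → (Fin d → ℕ) → ℂ

/-- `h` is 1-periodic in both arguments. -/
def IsBiperiodic (h : Plane → ℝ) : Prop :=
  ∀ x y : ℝ, h (x + 1, y) = h (x, y) ∧ h (x, y + 1) = h (x, y)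

/-- The Fourier mode `exp (2πi (k x + l y))`. -/
noncomputable def mode (k l : ℤ) (z : Plane) : ℂ :=
  Complex.exp (2 * Real.pi * Complex.I * (k * z.1 + l * z.2))

/-- The Taylor coefficient `(1 / m!) ∂^m G (0)`. The vector fed to the iterated derivative
consists of `m i` copies of the `i`-th basis vector for each `i`. -/
noncomputable def taylorCoeff {d : ℕ} (G : Param d → ℝ) (m : Fin d → ℕ) : ℝ :=
  ((∏ i, (m i).factorial : ℕ) : ℝ)⁻¹ *
    iteratedFDeriv ℝ (∑ i, m i) G 0
      (fun s => (Pi.single (finSigmaFinEquiv.symm s).1 1 : Param d))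

/-- The Fourier-Taylor coefficient `f_{k,l,m}` of `F μ (x, y)`: the `(k, l)` Fourier coefficient
of the `m`-th Taylor coefficient at `μ = 0`. -/
noncomputable def fourierTaylorCoeff {d : ℕ} (F : Param d → Plane → ℝ) : CoeffArray d :=
  fun k l m => ∫ x in (0 : ℝ)..1, ∫ y in (0 : ℝ)..1,
    (taylorCoeff (fun μ => F μ (x, y)) m : ℂ) * mode (-k) (-l) (x, y)

/-- The homogeneous polynomial of degree `j` in `μ`, `∑_{|m| = j} μ^m a_m(z)`. -/
noncomputable def homPart {d : ℕ} (a : (Fin d → ℕ) → Plane → ℝ) (j : ℕ)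
    (μ : Param d) (z : Plane) : ℝ :=
  ∑ m ∈ Finset.Nat.antidiagonalTuple d j, (∏ i, μ i ^ m i) * a m z

/-- The vector field `(p / q + F_μ(x, y)) ∂_x + ∂_y`. -/
noncomputable def oscillatorField {d : ℕ} (p q : ℤ) (F : Param d → Plane → ℝ)
    (μ : Param d) (z : Plane) : Plane :=
  ((p : ℝ) / (q : ℝ) + F μ z, 1)

/-- The vector field `g(x, y) ∂_x`. -/
def shearField (g : Plane → ℝ) (z : Plane) : Plane := (g z, 0)

/-- `φ` is the (complete) flow of the vector field `Y`. -/
def IsFlowOf (Y : Plane → Plane) (φ : ℝ → Plane → Plane) : Prop :=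
  ∀ z : Plane, φ 0 z = z ∧ ∀ t : ℝ, HasDerivAt (fun s => φ s z) (Y (φ t z)) t

/-- `ψ` is a smooth family of diffeomorphisms of the plane that are lifts of transformations of
the two-torus (homotopic to the identity), and `ψ μ = id + O(|μ|^j)` uniformly. -/
structure IsNearIdentity {d : ℕ} (j : ℕ) (ψ : Param d → Plane → Plane) : Prop where
  contDiff : ContDiff ℝ ∞ (fun w : Param d × Plane => ψ w.1 w.2)
  diffeo : ∀ μ, ∃ χ : Plane → Plane, ContDiff ℝ ∞ χ ∧
    Function.LeftInverse χ (ψ μ) ∧ Function.RightInverse χ (ψ μ)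
  lift : ∀ (μ : Param d) (z : Plane) (a b : ℤ),
    ψ μ (z + ((a : ℝ), (b : ℝ))) = ψ μ z + ((a : ℝ), (b : ℝ))
  near : ∃ C : ℝ, ∀ᶠ μ in nhds (0 : Param d), ∀ z : Plane, ‖ψ μ z - z‖ ≤ C * ‖μ‖ ^ j

/-- The family of vector fields `X` after the successive coordinate transformations
`ψ 1, …, ψ n`; the old coordinates are `ψ j μ` of the new ones in the `j`-th transformation. -/
noncomputable def transformed {d : ℕ} (ψ : ℕ → Param d → Plane → Plane)
    (X : Param d → Plane → Plane) : ℕ → Param d → Plane → Plane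
  | 0 => X
  | n + 1 => fun μ => VectorField.pullback ℝ (ψ (n + 1) μ) (transformed ψ X n μ)

end ForcedOscillator

/-! The vector field is normalised one degree in `μ` at a time. The coordinate change generated by
`g ∂_x`, with `g` homogeneous of degree `j`, replaces the degree `j` part `r` of the perturbation by
`r - (p/q ∂_x + ∂_y) g`, up to higher order. Since `p/q` is rational, every orbit of `X_0` is closed
on the torus. The mean of `r` over these orbits (`orbitMean`) is therefore smooth, and one explicit
integral (`orbitPrimitive`) solves `(p/q ∂_x + ∂_y) g = r - mean`, without small divisors
(`fderiv_orbitPrimitive`). The mean is invariant along `X_0`, so its Fourier series contains only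
resonant modes (`hasSum_resonant`). Averaging keeps the resonant coefficients
(`waveCoeff_orbitMean`), which gives the claim in degree one.

Orders in `μ` are handled algebraically: `Ord k` is the `k`-th power of the ideal generated by the
parameters in the ring of smooth biperiodic families. These powers are respected by products, phase
derivatives, slides in `x` and averages along flows, and Hadamard's lemma extracts leading parts.
The displacement of the time-one map lies in the `j`-th power and differs from its generator by an
element of the `2j`-th. With the pullback formula for maps `(x, y) ↦ (x + h, y)` this gives the
inductive step `exists_pullback_eq`, hence `exists_normal_form`.

The new coefficients have to depend on the coefficient array alone. No recursion for them is written
down. For each realisable array one representative `G` is fixed and normalised. Any `F` with the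
same array differs from `G` by an element of every power of the ideal
(`ord_sub_of_fourierTaylorCoeff_eq`), and the transformations built for `G` carry this difference
into the remainder (`exists_transformed_add`). Hence the normal form of `G` serves for `F`. A family
given only near `μ = 0` is first extended by a cutoff. -/

namespace ForcedOscillator

/-! ### Smoothness of integrals depending on parameters. -/

section ParametricIntegral

variable {H E : Type} [NormedAddCommGroup H] [NormedSpace ℝ H] [ProperSpace H]
  [NormedAddCommGroup E] [NormedSpace ℝ E]

/-- Differentiation under the integral sign, for an integrand whose derivative in the parameter
is jointly continuous. -/
theorem hasFDerivAt_intervalIntegral_param {f : ℝ → H → E} {f' : ℝ → H → H →L[ℝ] E} (a b : ℝ)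
    (hf : Continuous fun w : ℝ × H => f w.1 w.2)
    (hf' : Continuous fun w : ℝ × H => f' w.1 w.2)
    (hd : ∀ s x, HasFDerivAt (f s) (f' s x) x) (x₀ : H) :
    HasFDerivAt (fun x => ∫ s in a..b, f s x) (∫ s in a..b, f' s x₀) x₀ := by
  have hK : IsCompact (Set.uIcc a b ×ˢ Metric.closedBall x₀ 1) :=
    isCompact_uIcc.prod (isCompact_closedBall x₀ 1)
  obtain ⟨M, hM⟩ := hK.exists_bound_of_continuousOn hf'.continuousOn
  refine intervalIntegral.hasFDerivAt_integral_of_dominated_of_fderiv_le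
    (F := fun x s => f s x) (F' := fun x s => f' s x) (bound := fun _ => M)
    (Metric.ball_mem_nhds x₀ one_pos) ?_ ?_ ?_ ?_ ?_ ?_
  · refine Filter.Eventually.of_forall fun x => ?_
    exact (hf.comp (by fun_prop : Continuous fun s : ℝ => (s, x))).aestronglyMeasurable
  · exact (hf.comp (by fun_prop : Continuous fun s : ℝ => (s, x₀))).intervalIntegrable _ _
  · exact (hf'.comp (by fun_prop : Continuous fun s : ℝ => (s, x₀))).aestronglyMeasurable
  · refine Filter.Eventually.of_forall fun s hs x hx => ?_
    exact hM (s, x) ⟨Set.uIoc_subset_uIcc hs, Metric.ball_subset_closedBall hx⟩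
  · exact continuous_const.intervalIntegrable _ _
  · exact Filter.Eventually.of_forall fun s _ x _ => hd s x

theorem hasFDerivAt_intervalIntegral_of_contDiff {f : ℝ → H → E} (a b : ℝ)
    (hf : ContDiff ℝ 1 fun w : ℝ × H => f w.1 w.2) (x₀ : H) :
    HasFDerivAt (fun x => ∫ s in a..b, f s x)
      (∫ s in a..b, (fderiv ℝ (fun w : ℝ × H => f w.1 w.2) (s, x₀)).comp
        (ContinuousLinearMap.inr ℝ ℝ H)) x₀ := by
  refine hasFDerivAt_intervalIntegral_param a b
    (f' := fun s x => (fderiv ℝ (fun w : ℝ × H => f w.1 w.2) (s, x)).comp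
        (ContinuousLinearMap.inr ℝ ℝ H)) hf.continuous ?_ ?_ x₀
  · have := hf.continuous_fderiv one_ne_zero
    exact this.clm_comp continuous_const
  · intro s x
    have h1 := (hf.differentiable one_ne_zero (s, x)).hasFDerivAt
    have h2 : HasFDerivAt (fun y : H => (s, y)) (ContinuousLinearMap.inr ℝ ℝ H) x :=
      hasFDerivAt_prodMk_right s x
    exact h1.comp x h2

/-- The target space is quantified inside the induction because the derivative of the integrand
takes values in `H →L[ℝ] E` instead of `E`. -/
theorem contDiff_nat_intervalIntegral {H : Type} [NormedAddCommGroup H] [NormedSpace ℝ H]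
    [ProperSpace H] (a b : ℝ) (n : ℕ) :
    ∀ {E : Type} [NormedAddCommGroup E] [NormedSpace ℝ E] {f : ℝ → H → E},
      ContDiff ℝ n (fun w : ℝ × H => f w.1 w.2) → ContDiff ℝ n fun x => ∫ s in a..b, f s x := by
  induction n with
  | zero =>
    intro E _ _ f hf
    simp only [Nat.cast_zero, contDiff_zero] at hf ⊢
    have : Continuous (Function.uncurry fun (x : H) (s : ℝ) => f s x) :=
      hf.comp continuous_swap
    exact intervalIntegral.continuous_parametric_intervalIntegral_of_continuous' this a b
  | succ n ih =>
    intro E _ _ f hf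
    rw [Nat.cast_succ] at hf ⊢
    rw [contDiff_succ_iff_hasFDerivAt]
    refine ⟨_, ih ?_, hasFDerivAt_intervalIntegral_of_contDiff a b
      (hf.of_le (by simp))⟩
    have := hf.fderiv_right (m := n) le_rfl
    exact this.clm_comp contDiff_const

theorem contDiff_intervalIntegral {n : ℕ∞} {f : ℝ → H → E} (a b : ℝ)
    (hf : ContDiff ℝ n fun w : ℝ × H => f w.1 w.2) :
    ContDiff ℝ n fun x => ∫ s in a..b, f s x := by
  rw [contDiff_iff_forall_nat_le] at hf ⊢
  exact fun m hm => contDiff_nat_intervalIntegral a b m (hf m hm)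

/-- The primitive `∫₀ᵗ f` is as smooth, jointly in `t` and the parameters, as `f`. -/
theorem contDiff_primitive {n : ℕ∞} {f : ℝ → H → E}
    (hf : ContDiff ℝ n fun w : ℝ × H => f w.1 w.2) :
    ContDiff ℝ n fun w : ℝ × H => ∫ s in (0 : ℝ)..w.1, f s w.2 := by
  -- Rescaling to `[0, 1]` turns the moving endpoint into one more parameter of the integrand.
  have h1 : (fun w : ℝ × H => ∫ s in (0 : ℝ)..w.1, f s w.2) =
      fun w : ℝ × H => w.1 • ∫ s in (0 : ℝ)..1, f (w.1 * s) w.2 := by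
    funext w
    have := intervalIntegral.smul_integral_comp_mul_left (a := 0) (b := 1)
      (fun s => f s w.2) w.1
    simpa using this.symm
  rw [h1]
  refine contDiff_fst.smul ?_
  refine contDiff_intervalIntegral (f := fun (s : ℝ) (w : ℝ × H) => f (w.1 * s) w.2) 0 1 ?_
  have h2 : ContDiff ℝ n fun w : ℝ × ℝ × H => (w.2.1 * w.1, w.2.2) := by fun_prop
  exact hf.comp h2

end ParametricIntegral

/-! ### Smooth dependence on parameters for scalar differential equations. -/

section ScalarODE

/-- The mean of the derivative of `Γ` over the segment from `w₀` to `w`. -/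
noncomputable def meanFDeriv {W : Type} [NormedAddCommGroup W] [NormedSpace ℝ W]
    (Γ : W → ℝ) (w w₀ : W) : W →L[ℝ] ℝ :=
  ∫ θ in (0 : ℝ)..1, fderiv ℝ Γ (w₀ + θ • (w - w₀))

section Mean

variable {W : Type} [NormedAddCommGroup W] [NormedSpace ℝ W] {Γ : W → ℝ}

/-- This factorisation of an increment is exact, so the difference of two solutions of a nonlinear
equation solves a linear one. -/
theorem meanFDeriv_apply_sub (hΓ : ContDiff ℝ 1 Γ) (w w₀ : W) :
    meanFDeriv Γ w w₀ (w - w₀) = Γ w - Γ w₀ := by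
  have hc : Continuous fun θ : ℝ => fderiv ℝ Γ (w₀ + θ • (w - w₀)) :=
    (hΓ.continuous_fderiv one_ne_zero).comp (by fun_prop)
  rw [meanFDeriv, ContinuousLinearMap.intervalIntegral_apply (hc.intervalIntegrable _ _)]
  have hd : ∀ θ ∈ Set.uIcc (0 : ℝ) 1, HasDerivAt (fun θ : ℝ => Γ (w₀ + θ • (w - w₀)))
      (fderiv ℝ Γ (w₀ + θ • (w - w₀)) (w - w₀)) θ := by
    intro θ _
    have h1 : HasDerivAt (fun θ : ℝ => w₀ + θ • (w - w₀)) (w - w₀) θ := by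
      simpa using ((hasDerivAt_id θ).smul_const (w - w₀)).const_add w₀
    exact ((hΓ.differentiable one_ne_zero _).hasFDerivAt).comp_hasDerivAt θ h1
  rw [intervalIntegral.integral_eq_sub_of_hasDerivAt hd
    ((hc.clm_apply continuous_const).intervalIntegrable _ _)]
  simp

theorem continuous_meanFDeriv (hΓ : ContDiff ℝ 1 Γ) :
    Continuous fun w : W × W => meanFDeriv Γ w.1 w.2 := by
  have hc := hΓ.continuous_fderiv one_ne_zero
  unfold meanFDeriv
  refine intervalIntegral.continuous_parametric_intervalIntegral_of_continuous' ?_ 0 1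
  exact hc.comp (by fun_prop : Continuous fun p : (W × W) × ℝ => p.1.2 + p.2 • (p.1.1 - p.1.2))

theorem meanFDeriv_self (w : W) : meanFDeriv Γ w w = fderiv ℝ Γ w := by
  simp [meanFDeriv]

theorem norm_meanFDeriv_le {s : Set W} (hs : Convex ℝ s) {M : ℝ}
    (hM : ∀ x ∈ s, ‖fderiv ℝ Γ x‖ ≤ M) {w w₀ : W} (hw : w ∈ s) (hw₀ : w₀ ∈ s) :
    ‖meanFDeriv Γ w w₀‖ ≤ M := by
  have := intervalIntegral.norm_integral_le_of_norm_le_const (a := 0) (b := 1) (C := M)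
    (f := fun θ : ℝ => fderiv ℝ Γ (w₀ + θ • (w - w₀))) (fun θ hθ => by
      rw [Set.uIoc_of_le zero_le_one] at hθ
      exact hM _ (hs.add_smul_sub_mem hw₀ hw ⟨hθ.1.le, hθ.2⟩))
  simpa [meanFDeriv] using this

end Mean

/-- Variation of constants for a scalar linear equation. -/
theorem eq_integral_of_linear_ode {Δ a B : ℝ → ℝ} (ha : Continuous a) (hB : Continuous B)
    (h0 : Δ 0 = 0) (hΔ : ∀ t, HasDerivAt Δ (a t + B t * Δ t) t) (t : ℝ) :
    Δ t = Real.exp (∫ s in (0 : ℝ)..t, B s) *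
      ∫ s in (0 : ℝ)..t, Real.exp (-∫ r in (0 : ℝ)..s, B r) * a s := by
  set β : ℝ → ℝ := fun t => ∫ s in (0 : ℝ)..t, B s with hβ
  have hβd : ∀ t, HasDerivAt β (B t) t := fun t => hB.integral_hasStrictDerivAt 0 t |>.hasDerivAt
  have hβc : Continuous β := continuous_iff_continuousAt.2 fun t => (hβd t).continuousAt
  have hd : ∀ s ∈ Set.uIcc (0 : ℝ) t,
      HasDerivAt (fun s => Real.exp (-β s) * Δ s) (Real.exp (-β s) * a s) s := by
    intro s _
    refine ((hβd s).fun_neg.exp.mul (hΔ s)).congr_deriv ?_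
    ring
  have hI := intervalIntegral.integral_eq_sub_of_hasDerivAt hd
    ((by fun_prop : Continuous fun s => Real.exp (-β s) * a s).intervalIntegrable _ _)
  rw [hI, h0, mul_zero, sub_zero, ← mul_assoc, ← Real.exp_add, add_neg_cancel,
    Real.exp_zero, one_mul]

/-- A Gronwall bound, read off from the variation of constants formula. -/
theorem abs_le_of_linear_ode {Δ a B : ℝ → ℝ} (ha : Continuous a) (hB : Continuous B)
    (h0 : Δ 0 = 0) (hΔ : ∀ t, HasDerivAt Δ (a t + B t * Δ t) t) {M N : ℝ}
    (hM : ∀ t, |B t| ≤ M) (hN : ∀ t, |a t| ≤ N) (t : ℝ) :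
    |Δ t| ≤ Real.exp (M * |t|) * (Real.exp (M * |t|) * N * |t|) := by
  have hM0 : 0 ≤ M := (abs_nonneg _).trans (hM 0)
  have hN0 : 0 ≤ N := (abs_nonneg _).trans (hN 0)
  have hβ : ∀ s, |∫ r in (0 : ℝ)..s, B r| ≤ M * |s| := fun s => by
    simpa using intervalIntegral.norm_integral_le_of_norm_le_const (a := 0) (b := s) (C := M)
      (f := B) (fun r _ => hM r)
  rw [eq_integral_of_linear_ode ha hB h0 hΔ t, abs_mul, Real.abs_exp]
  refine mul_le_mul (Real.exp_le_exp.2 ((le_abs_self _).trans (hβ t))) ?_ (abs_nonneg _)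
    (Real.exp_pos _).le
  have := intervalIntegral.norm_integral_le_of_norm_le_const (a := 0) (b := t)
    (C := Real.exp (M * |t|) * N)
    (f := fun s => Real.exp (-∫ r in (0 : ℝ)..s, B r) * a s) (fun s hs => by
      rw [norm_mul, Real.norm_eq_abs, Real.norm_eq_abs, Real.abs_exp]
      refine mul_le_mul (Real.exp_le_exp.2 ?_) (hN s) (abs_nonneg _) (Real.exp_pos _).le
      refine (neg_le_abs _).trans ((hβ s).trans (mul_le_mul_of_nonneg_left ?_ hM0))
      have h := Set.uIoc_subset_uIcc hs
      simpa using Set.abs_sub_left_of_mem_uIcc h)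
  simpa using this

/-- Carathéodory's criterion for differentiability. -/
theorem hasFDerivAt_of_eq_clm_apply_sub {E F : Type} [NormedAddCommGroup E] [NormedSpace ℝ E]
    [NormedAddCommGroup F] [NormedSpace ℝ F] {f : E → F} {K : E → E →L[ℝ] F} {x₀ : E}
    (hK : ContinuousAt K x₀) (h : ∀ x, f x - f x₀ = K x (x - x₀)) :
    HasFDerivAt f (K x₀) x₀ := by
  rw [hasFDerivAt_iff_isLittleO, Asymptotics.isLittleO_iff]
  intro c hc
  filter_upwards [Metric.continuousAt_iff'.1 hK c hc] with x hx
  rw [h, ← sub_apply]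
  refine (ContinuousLinearMap.le_opNorm _ _).trans ?_
  gcongr
  rw [← dist_eq_norm]
  exact hx.le

variable {E : Type} [NormedAddCommGroup E] [NormedSpace ℝ E]

/-- `u` solves `∂ₜ u = Γ (ζ, u)`, `u (0) = 0` for all values of the parameter `ζ`; the right-hand
side is smooth and its derivative is bounded in `u`, locally uniformly in `ζ`. -/
structure IsScalarFlow (Γ : E × ℝ → ℝ) (u : ℝ → E → ℝ) : Prop where
  smooth : ContDiff ℝ ∞ Γ
  bound : ∀ ζ₀ : E, ∃ M : ℝ, ∀ ζ ∈ Metric.closedBall ζ₀ 1, ∀ v, ‖fderiv ℝ Γ (ζ, v)‖ ≤ M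
  zero : ∀ ζ, u 0 ζ = 0
  ode : ∀ ζ t, HasDerivAt (fun s => u s ζ) (Γ (ζ, u t ζ)) t

namespace IsScalarFlow

variable {Γ : E × ℝ → ℝ} {u : ℝ → E → ℝ} (hu : IsScalarFlow Γ u)
include hu

theorem continuous_time (ζ : E) : Continuous fun t => u t ζ :=
  continuous_iff_continuousAt.2 fun t => (hu.ode ζ t).continuousAt

theorem smooth_one : ContDiff ℝ 1 Γ := hu.smooth.of_le (by norm_cast)

/-- The difference of two solutions solves a linear equation. -/
theorem hasDerivAt_sub (ζ ζ₀ : E) (t : ℝ) :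
    HasDerivAt (fun s => u s ζ - u s ζ₀)
      (meanFDeriv Γ (ζ, u t ζ) (ζ₀, u t ζ₀) (ζ - ζ₀, 0) +
        meanFDeriv Γ (ζ, u t ζ) (ζ₀, u t ζ₀) (0, 1) * (u t ζ - u t ζ₀)) t := by
  refine ((hu.ode ζ t).sub (hu.ode ζ₀ t)).congr_deriv ?_
  rw [← meanFDeriv_apply_sub hu.smooth_one, mul_comm, ← smul_eq_mul, ← map_smul, ← map_add]
  simp

theorem continuous_mean (ζ ζ₀ : E) :
    Continuous fun t => meanFDeriv Γ (ζ, u t ζ) (ζ₀, u t ζ₀) := by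
  have h1 := hu.continuous_time ζ
  have h2 := hu.continuous_time ζ₀
  exact (continuous_meanFDeriv hu.smooth_one).comp
    (by fun_prop : Continuous fun t => (((ζ, u t ζ), (ζ₀, u t ζ₀)) : (E × ℝ) × (E × ℝ)))

/-- The Gronwall bound gives a Lipschitz estimate at `ζ₀`, locally uniform in time; continuity in
`t` for fixed `ζ₀` does the rest. -/
theorem continuous : Continuous fun w : ℝ × E => u w.1 w.2 := by
  rw [continuous_iff_continuousAt]
  rintro ⟨t₀, ζ₀⟩
  obtain ⟨M, hM⟩ := hu.bound ζ₀
  have hM' : ∀ x ∈ Metric.closedBall ζ₀ 1 ×ˢ (Set.univ : Set ℝ), ‖fderiv ℝ Γ x‖ ≤ M :=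
    fun x hx => hM x.1 hx.1 x.2
  have hconv : Convex ℝ (Metric.closedBall ζ₀ 1 ×ˢ (Set.univ : Set ℝ)) :=
    (convex_closedBall _ _).prod convex_univ
  have hlip : ∀ ζ ∈ Metric.closedBall ζ₀ 1, ∀ t, |u t ζ - u t ζ₀| ≤
      Real.exp (M * |t|) * (Real.exp (M * |t|) * (M * ‖ζ - ζ₀‖) * |t|) := by
    intro ζ hζ t
    have hD : ∀ s, ‖meanFDeriv Γ (ζ, u s ζ) (ζ₀, u s ζ₀)‖ ≤ M := fun s =>
      norm_meanFDeriv_le hconv hM' ⟨hζ, trivial⟩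
        ⟨Metric.mem_closedBall_self zero_le_one, trivial⟩
    have hc := hu.continuous_mean ζ ζ₀
    refine abs_le_of_linear_ode (Δ := fun s => u s ζ - u s ζ₀)
      (hc.clm_apply continuous_const) (hc.clm_apply continuous_const)
      (by simp [hu.zero]) (hu.hasDerivAt_sub ζ ζ₀) (fun s => ?_) (fun s => ?_) t
    · refine ((meanFDeriv Γ (ζ, u s ζ) (ζ₀, u s ζ₀)).le_opNorm (0, 1)).trans ?_
      simpa using hD s
    · refine ((meanFDeriv Γ (ζ, u s ζ) (ζ₀, u s ζ₀)).le_opNorm (ζ - ζ₀, 0)).trans ?_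
      have : ‖(ζ - ζ₀, (0 : ℝ))‖ = ‖ζ - ζ₀‖ := by simp
      rw [this]
      exact mul_le_mul_of_nonneg_right (hD s) (norm_nonneg _)
  have h1 : Filter.Tendsto (fun w : ℝ × E => u w.1 w.2 - u w.1 ζ₀) (nhds (t₀, ζ₀)) (nhds 0) := by
    refine squeeze_zero_norm' (a := fun w : ℝ × E => Real.exp (M * |w.1|) *
      (Real.exp (M * |w.1|) * (M * ‖w.2 - ζ₀‖) * |w.1|)) ?_ ?_
    · have : ∀ᶠ w : ℝ × E in nhds (t₀, ζ₀), w.2 ∈ Metric.closedBall ζ₀ 1 :=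
        continuous_snd.continuousAt (Metric.closedBall_mem_nhds ζ₀ one_pos)
      filter_upwards [this] with w hw using hlip w.2 hw w.1
    · have : Continuous fun w : ℝ × E => Real.exp (M * |w.1|) *
        (Real.exp (M * |w.1|) * (M * ‖w.2 - ζ₀‖) * |w.1|) := by fun_prop
      simpa using this.tendsto (t₀, ζ₀)
  have h2 : Filter.Tendsto (fun w : ℝ × E => u w.1 ζ₀) (nhds (t₀, ζ₀)) (nhds (u t₀ ζ₀)) :=
    ((hu.continuous_time ζ₀).comp continuous_fst).tendsto (t₀, ζ₀)
  have h3 := h1.add h2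
  simpa [ContinuousAt] using h3

/-- The derivative of the flow in the parameter. -/
theorem hasFDerivAt_param (t : ℝ) (ζ₀ : E) :
    HasFDerivAt (fun ζ => u t ζ)
      (Real.exp (∫ s in (0 : ℝ)..t, fderiv ℝ Γ (ζ₀, u s ζ₀) (0, 1)) •
        ∫ s in (0 : ℝ)..t, Real.exp (-∫ r in (0 : ℝ)..s, fderiv ℝ Γ (ζ₀, u r ζ₀) (0, 1)) •
          (fderiv ℝ Γ (ζ₀, u s ζ₀)).comp (ContinuousLinearMap.inl ℝ E ℝ)) ζ₀ := by
  have huc := hu.continuous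
  have hu0 := hu.continuous_time ζ₀
  have hD : Continuous fun w : E × ℝ => meanFDeriv Γ (w.1, u w.2 w.1) (ζ₀, u w.2 ζ₀) := by
    have h1 : Continuous fun w : E × ℝ => u w.2 w.1 := huc.comp continuous_swap
    exact (continuous_meanFDeriv hu.smooth_one).comp
      (by fun_prop :
        Continuous fun w : E × ℝ => (((w.1, u w.2 w.1), (ζ₀, u w.2 ζ₀)) : (E × ℝ) × (E × ℝ)))
  have hB : Continuous fun w : E × ℝ =>
      meanFDeriv Γ (w.1, u w.2 w.1) (ζ₀, u w.2 ζ₀) (0, 1) := hD.clm_apply continuous_const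
  have hA : Continuous fun w : E × ℝ =>
      (meanFDeriv Γ (w.1, u w.2 w.1) (ζ₀, u w.2 ζ₀)).comp (ContinuousLinearMap.inl ℝ E ℝ) :=
    hD.clm_comp continuous_const
  have hβ : Continuous fun w : E × ℝ => ∫ r in (0 : ℝ)..w.2,
      meanFDeriv Γ (w.1, u r w.1) (ζ₀, u r ζ₀) (0, 1) := by
    refine intervalIntegral.continuous_parametric_intervalIntegral_of_continuous
      (f := fun (w : E × ℝ) r => meanFDeriv Γ (w.1, u r w.1) (ζ₀, u r ζ₀) (0, 1)) ?_ continuous_snd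
    exact hB.comp (by fun_prop : Continuous fun w : (E × ℝ) × ℝ => (w.1.1, w.2))
  have hInt : Continuous fun w : E × ℝ =>
      Real.exp (-∫ r in (0 : ℝ)..w.2, meanFDeriv Γ (w.1, u r w.1) (ζ₀, u r ζ₀) (0, 1)) •
        (meanFDeriv Γ (w.1, u w.2 w.1) (ζ₀, u w.2 ζ₀)).comp (ContinuousLinearMap.inl ℝ E ℝ) :=
    (Real.continuous_exp.comp hβ.neg).smul hA
  -- By variation of constants `u t ζ - u t ζ₀` is exactly `K ζ (ζ - ζ₀)`, so continuity of `K`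
  -- yields the derivative `K ζ₀`, where the mean derivatives become genuine ones.
  set K : E → E →L[ℝ] ℝ := fun ζ =>
    Real.exp (∫ s in (0 : ℝ)..t, meanFDeriv Γ (ζ, u s ζ) (ζ₀, u s ζ₀) (0, 1)) •
      ∫ s in (0 : ℝ)..t,
        Real.exp (-∫ r in (0 : ℝ)..s, meanFDeriv Γ (ζ, u r ζ) (ζ₀, u r ζ₀) (0, 1)) •
        (meanFDeriv Γ (ζ, u s ζ) (ζ₀, u s ζ₀)).comp (ContinuousLinearMap.inl ℝ E ℝ) with hK
  have hKc : Continuous K := by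
    refine (Real.continuous_exp.comp (hβ.comp (by fun_prop : Continuous fun ζ : E => (ζ, t)))).smul
      ?_
    exact intervalIntegral.continuous_parametric_intervalIntegral_of_continuous'
      (f := fun (ζ : E) s => Real.exp
        (-∫ r in (0 : ℝ)..s, meanFDeriv Γ (ζ, u r ζ) (ζ₀, u r ζ₀) (0, 1)) •
        (meanFDeriv Γ (ζ, u s ζ) (ζ₀, u s ζ₀)).comp (ContinuousLinearMap.inl ℝ E ℝ)) hInt 0 t
  have key := hasFDerivAt_of_eq_clm_apply_sub (f := fun ζ => u t ζ) (x₀ := ζ₀) hKc.continuousAt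
    (fun ζ => by
      have hc := hu.continuous_mean ζ ζ₀
      rw [eq_integral_of_linear_ode (Δ := fun s => u s ζ - u s ζ₀)
        (hc.clm_apply continuous_const) (hc.clm_apply continuous_const)
        (by simp [hu.zero]) (hu.hasDerivAt_sub ζ ζ₀) t]
      rw [hK, smul_apply, ContinuousLinearMap.intervalIntegral_apply, smul_eq_mul]
      · simp
      · exact (hInt.comp (by fun_prop : Continuous fun s : ℝ => (ζ, s))).intervalIntegrable _ _)
  simpa only [hK, meanFDeriv_self] using key

/-- Smooth dependence on parameters. -/
theorem contDiff [ProperSpace E] : ContDiff ℝ ∞ fun w : ℝ × E => u w.1 w.2 := by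
  rw [contDiff_infty]
  intro n
  -- Both partial derivatives are expressed through `u` and primitives along it, so if `u` is of
  -- class `C^n`, its derivative is too.
  induction n with
  | zero => simpa using hu.continuous
  | succ n ih =>
    rw [Nat.cast_succ, contDiff_succ_iff_hasFDerivAt]
    have hw : ContDiff ℝ n fun w : ℝ × E => (w.2, u w.1 w.2) := contDiff_snd.prodMk ih
    have hΓ' : ContDiff ℝ n fun w : ℝ × E => fderiv ℝ Γ (w.2, u w.1 w.2) :=
      (hu.smooth.fderiv_right (m := n) (by norm_cast; exact le_top)).comp hw
    have hβ : ContDiff ℝ n fun w : ℝ × E =>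
        ∫ s in (0 : ℝ)..w.1, fderiv ℝ Γ (w.2, u s w.2) (0, 1) :=
      contDiff_primitive (n := n) (f := fun s ζ => fderiv ℝ Γ (ζ, u s ζ) (0, 1))
        (hΓ'.clm_apply contDiff_const)
    have hK : ContDiff ℝ n fun w : ℝ × E =>
        Real.exp (∫ s in (0 : ℝ)..w.1, fderiv ℝ Γ (w.2, u s w.2) (0, 1)) •
        ∫ s in (0 : ℝ)..w.1, Real.exp (-∫ r in (0 : ℝ)..s, fderiv ℝ Γ (w.2, u r w.2) (0, 1)) •
          (fderiv ℝ Γ (w.2, u s w.2)).comp (ContinuousLinearMap.inl ℝ E ℝ) := by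
      refine hβ.exp.smul (contDiff_primitive (n := n) (f := fun s ζ =>
        Real.exp (-∫ r in (0 : ℝ)..s, fderiv ℝ Γ (ζ, u r ζ) (0, 1)) •
          (fderiv ℝ Γ (ζ, u s ζ)).comp (ContinuousLinearMap.inl ℝ E ℝ)) ?_)
      exact hβ.neg.exp.smul (hΓ'.clm_comp contDiff_const)
    have hT : ContDiff ℝ n fun w : ℝ × E =>
        (ContinuousLinearMap.toSpanSingleton ℝ (Γ (w.2, u w.1 w.2)) : ℝ →L[ℝ] ℝ) := by
      have h1 : ContDiff ℝ n fun w : ℝ × E => Γ (w.2, u w.1 w.2) :=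
        (hu.smooth.of_le (by norm_cast; exact le_top)).comp hw
      exact (ContinuousLinearMap.toSpanSingletonCLE (𝕜 := ℝ) (E := ℝ)).contDiff.comp h1
    have hTK := (hT.clm_comp (contDiff_const (c := ContinuousLinearMap.fst ℝ ℝ E))).add
      (hK.clm_comp (contDiff_const (c := ContinuousLinearMap.snd ℝ ℝ E)))
    refine ⟨_, hTK, fun w => ?_⟩
    have key := (hasStrictFDerivAt_uncurry_coprod (u := w) (f := u)
      (f₁ := fun t ζ => ContinuousLinearMap.toSpanSingleton ℝ (Γ (ζ, u t ζ))) (f₂ := fun t ζ =>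
        Real.exp (∫ s in (0 : ℝ)..t, fderiv ℝ Γ (ζ, u s ζ) (0, 1)) •
        ∫ s in (0 : ℝ)..t, Real.exp (-∫ r in (0 : ℝ)..s, fderiv ℝ Γ (ζ, u r ζ) (0, 1)) •
          (fderiv ℝ Γ (ζ, u s ζ)).comp (ContinuousLinearMap.inl ℝ E ℝ))
      (Filter.Eventually.of_forall fun v => (hu.ode v.2 v.1).hasFDerivAt)
      (Filter.Eventually.of_forall fun v => hu.hasFDerivAt_param v.1 v.2)
      hT.continuous.continuousAt hK.continuous.continuousAt).hasFDerivAt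
    refine key.congr_fderiv ?_
    exact ContinuousLinearMap.ext fun v => rfl

end IsScalarFlow

end ScalarODE

/-! ### Global integral curves on the line. -/

section GlobalSolution

theorem exists_lipschitzWith_bound_of_periodic {f : ℝ → ℝ} (hf : ContDiff ℝ 1 f)
    (hp : Function.Periodic f 1) :
    ∃ K L : NNReal, LipschitzWith K f ∧ ∀ x, ‖f x‖ ≤ L := by
  have hp' : Function.Periodic (deriv f) 1 := fun x => by
    have h : (fun y => f (y + 1)) = f := funext hp
    rw [← deriv_comp_add_const, h]
  obtain ⟨K, hK⟩ := (hp'.isBounded_of_continuous one_ne_zero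
    (hf.continuous_deriv le_rfl)).exists_norm_le
  obtain ⟨L, hL⟩ := (hp.isBounded_of_continuous one_ne_zero hf.continuous).exists_norm_le
  have hK0 : 0 ≤ K := (norm_nonneg _).trans (hK _ ⟨0, rfl⟩)
  have hL0 : 0 ≤ L := (norm_nonneg _).trans (hL _ ⟨0, rfl⟩)
  refine ⟨⟨K, hK0⟩, ⟨L, hL0⟩, ?_, fun x => hL _ ⟨x, rfl⟩⟩
  exact lipschitzWith_of_nnnorm_deriv_le (hf.differentiable one_ne_zero) fun x => hK _ ⟨x, rfl⟩

/-- A bounded Lipschitz vector field on the line has globally defined integral curves. -/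
theorem exists_global_solution {f : ℝ → ℝ} {K L : NNReal} (hK : LipschitzWith K f)
    (hL : ∀ x, ‖f x‖ ≤ L) : ∃ u : ℝ → ℝ, u 0 = 0 ∧ ∀ t, HasDerivAt u (f (u t)) t := by
  -- A curve with speed at most `L` stays within distance `L * (n + 1)` for times up to `n + 1`, so
  -- Picard-Lindelöf applies on the whole interval.
  have hex : ∀ n : ℕ, ∃ α : ℝ → ℝ, α 0 = 0 ∧
      ∀ t ∈ Set.Ioo (-(n : ℝ) - 1) (n + 1), HasDerivAt α (f (α t)) t := by
    intro n
    have h0 : (0 : ℝ) ∈ Set.Icc (-(n : ℝ) - 1) (n + 1) := by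
      constructor <;> linarith [(Nat.cast_nonneg n : (0 : ℝ) ≤ n)]
    have hpl : IsPicardLindelof (fun _ => f) (⟨0, h0⟩ : Set.Icc (-(n : ℝ) - 1) (n + 1)) 0
        (L * (n + 1)) 0 L K := by
      refine IsPicardLindelof.of_time_independent (fun x _ => hL x) hK.lipschitzOnWith ?_
      have : max ((n : ℝ) + 1 - 0) (0 - (-(n : ℝ) - 1)) = n + 1 := by
        rw [max_eq_left] <;> linarith
      simp only [this]
      simp
    obtain ⟨α, h1, h2⟩ := hpl.exists_eq_forall_mem_Icc_hasDerivWithinAt₀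
    exact ⟨α, h1, fun t ht =>
      (h2 t (Set.Ioo_subset_Icc_self ht)).hasDerivAt (Icc_mem_nhds ht.1 ht.2)⟩
  choose α hα0 hα using hex
  have hmono : ∀ m n : ℕ, m ≤ n → ∀ t ∈ Set.Ioo (-(m : ℝ) - 1) (m + 1), α n t = α m t := by
    intro m n hmn t ht
    have hc : (m : ℝ) ≤ n := by exact_mod_cast hmn
    have hm0 := (Nat.cast_nonneg m : (0 : ℝ) ≤ m)
    refine ODE_solution_unique_of_mem_Ioo (v := fun _ => f) (s := fun _ => Set.univ)
      (t₀ := 0) (fun _ _ => hK.lipschitzOnWith) ?_ (fun s hs => ⟨hα n s ?_, trivial⟩)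
      (fun s hs => ⟨hα m s hs, trivial⟩) ((hα0 n).trans (hα0 m).symm) ht
    · constructor <;> linarith
    · exact ⟨by linarith [hs.1], by linarith [hs.2]⟩
  have hmem : ∀ t : ℝ, ∀ n : ℕ, ⌈|t|⌉₊ ≤ n → t ∈ Set.Ioo (-(n : ℝ) - 1) (n + 1) := by
    intro t n hn
    have h1 := (Nat.le_ceil |t|).trans (by exact_mod_cast hn : (⌈|t|⌉₊ : ℝ) ≤ n)
    have h2 := abs_le.1 h1
    exact ⟨by linarith, by linarith⟩
  -- The local solutions agree on overlaps, so the value at `t` may be taken from any interval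
  -- containing `t`.
  refine ⟨fun t => α ⌈|t|⌉₊ t, by simp [hα0], fun t => ?_⟩
  have hder := hα ⌈|t|⌉₊ t (hmem t _ le_rfl)
  refine hder.congr_of_eventuallyEq ?_
  filter_upwards [isOpen_Ioo.mem_nhds (hmem t _ le_rfl)] with s hs
  rcases le_total ⌈|s|⌉₊ ⌈|t|⌉₊ with h | h
  · exact (hmono _ _ h s (hmem s _ le_rfl)).symm
  · exact hmono _ _ h s hs

end GlobalSolution

/-! ### Biperiodic families and integer translations. -/

/-- A smooth family of smooth functions, each 1-periodic in `x` and `y`. -/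
structure SmoothPer {d : ℕ} (S : Param d → Plane → ℝ) : Prop where
  smooth : ContDiff ℝ ∞ fun w : Param d × Plane => S w.1 w.2
  per : ∀ μ, IsBiperiodic (S μ)

theorem IsBiperiodic.add_int {h : Plane → ℝ} (hh : IsBiperiodic h) (z : Plane) (a b : ℤ) :
    h (z + ((a : ℝ), (b : ℝ))) = h z := by
  have h1 : Function.Periodic (fun x => h (x, z.2 + b)) 1 := fun x => (hh x (z.2 + b)).1
  have h2 : Function.Periodic (fun y => h (z.1, y)) 1 := fun y => (hh z.1 y).2
  have e1 := (h1.int_mul a) z.1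
  have e2 := (h2.int_mul b) z.2
  simp only [mul_one] at e1 e2
  rw [← Prod.mk.eta (p := z), Prod.mk_add_mk]
  exact e1.trans e2

theorem isBiperiodic_of_add_int {h : Plane → ℝ}
    (hh : ∀ (z : Plane) (a b : ℤ), h (z + ((a : ℝ), (b : ℝ))) = h z) : IsBiperiodic h := by
  intro x y
  have h1 := hh (x, y) 1 0
  have h2 := hh (x, y) 0 1
  simp only [Prod.mk_add_mk, Int.cast_one, Int.cast_zero, add_zero] at h1 h2
  exact ⟨h1, h2⟩

/-- Reduces bounds that are uniform on the plane to compactness of the unit square. -/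
theorem exists_int_translate (z : Plane) :
    ∃ a b : ℤ, z + ((a : ℝ), (b : ℝ)) ∈ Set.Icc (0 : ℝ) 1 ×ˢ Set.Icc (0 : ℝ) 1 := by
  refine ⟨-⌊z.1⌋, -⌊z.2⌋, ?_⟩
  have h1 := Int.fract_nonneg z.1
  have h2 := Int.fract_nonneg z.2
  have h3 := (Int.fract_lt_one z.1).le
  have h4 := (Int.fract_lt_one z.2).le
  have e1 : z.1 + ((-⌊z.1⌋ : ℤ) : ℝ) = Int.fract z.1 := by
    rw [Int.fract]; push_cast; ring
  have e2 : z.2 + ((-⌊z.2⌋ : ℤ) : ℝ) = Int.fract z.2 := by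
    rw [Int.fract]; push_cast; ring
  simp only [Set.mem_prod, Prod.fst_add, Prod.snd_add, e1, e2]
  exact ⟨⟨h1, h3⟩, h2, h4⟩

/-! ### The flow of `G μ ∂_x`, described by its displacement in `x`. -/

section ShearFlow

variable {d : ℕ}

/-- `z` moved by `h` in the `x`-direction. -/
def slide (h : ℝ) (z : Plane) : Plane := (z.1 + h, z.2)

/-- `u t (μ, z)` is the displacement of `z` after time `t` under the flow of `G μ ∂_x`. -/
def IsShearFlow (G : Param d → Plane → ℝ) (u : ℝ → Param d × Plane → ℝ) : Prop :=
  IsScalarFlow (fun w : (Param d × Plane) × ℝ => G w.1.1 (slide w.2 w.1.2)) u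

theorem contDiff_slide {n : WithTop ℕ∞} :
    ContDiff ℝ n fun w : ℝ × Plane => slide w.1 w.2 := by
  unfold slide; fun_prop

theorem slide_zero (z : Plane) : slide 0 z = z := by simp [slide]

theorem slide_slide (h k : ℝ) (z : Plane) : slide h (slide k z) = slide (k + h) z := by
  simp [slide, add_assoc]

theorem slide_add (h : ℝ) (z w : Plane) : slide h (z + w) = slide h z + w :=
  Prod.ext (by simp [slide]; ring) (by simp [slide])

namespace SmoothPer

variable {G : Param d → Plane → ℝ} (hG : SmoothPer G)
include hG

theorem smooth_shear :
    ContDiff ℝ ∞ fun w : (Param d × Plane) × ℝ => G w.1.1 (slide w.2 w.1.2) := by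
  have h1 : ContDiff ℝ ∞ fun w : (Param d × Plane) × ℝ => (w.1.1, slide w.2 w.1.2) := by
    unfold slide; fun_prop
  exact hG.smooth.comp h1

theorem smooth_slide (μ : Param d) (z : Plane) : ContDiff ℝ ∞ fun v => G μ (slide v z) := by
  have h1 : ContDiff ℝ ∞ fun v : ℝ => ((μ, z), v) := by fun_prop
  exact hG.smooth_shear.comp h1

theorem periodic_slide (μ : Param d) (z : Plane) :
    Function.Periodic (fun v => G μ (slide v z)) 1 := by
  intro v
  have := (hG.per μ).add_int (slide v z) 1 0
  simpa [slide, add_assoc] using this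

theorem exists_lipschitzWith_slide (μ : Param d) (z : Plane) :
    ∃ K L : NNReal, LipschitzWith K (fun v => G μ (slide v z)) ∧ ∀ v, ‖G μ (slide v z)‖ ≤ L :=
  exists_lipschitzWith_bound_of_periodic ((hG.smooth_slide μ z).of_le (by norm_cast))
    (hG.periodic_slide μ z)

theorem exists_shearFlow : ∃ u, IsShearFlow G u := by
  have hex : ∀ ζ : Param d × Plane, ∃ u : ℝ → ℝ, u 0 = 0 ∧
      ∀ t, HasDerivAt u (G ζ.1 (slide (u t) ζ.2)) t := by
    intro ζ
    obtain ⟨K, L, hK, hL⟩ := hG.exists_lipschitzWith_slide ζ.1 ζ.2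
    exact exists_global_solution hK hL
  choose u hu0 hu using hex
  refine ⟨fun t ζ => u ζ t, hG.smooth_shear, fun ζ₀ => ?_, hu0, hu⟩
  have hK : IsCompact (Metric.closedBall ζ₀ 1 ×ˢ Set.Icc (0 : ℝ) 1) :=
    (isCompact_closedBall ζ₀ 1).prod isCompact_Icc
  obtain ⟨M, hM⟩ := hK.exists_bound_of_continuousOn
    (hG.smooth_shear.continuous_fderiv (by simp)).continuousOn
  refine ⟨M, fun ζ hζ v => ?_⟩
  -- Periodicity in `x` makes the right-hand side 1-periodic in `v`, so a bound for `v` in `[0, 1]`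
  -- holds for all `v`.
  have hper : ∀ n : ℤ, (fun w : (Param d × Plane) × ℝ =>
      G (w + (0, (n : ℝ))).1.1 (slide (w + (0, (n : ℝ))).2 (w + (0, (n : ℝ))).1.2)) =
      fun w : (Param d × Plane) × ℝ => G w.1.1 (slide w.2 w.1.2) := by
    intro n
    funext w
    have := (hG.periodic_slide w.1.1 w.1.2).int_mul n w.2
    simpa using this
  have h1 := hM (ζ, Int.fract v) ⟨hζ, Int.fract_nonneg v, (Int.fract_lt_one v).le⟩
  have h2 : ((ζ, v) : (Param d × Plane) × ℝ) = (ζ, Int.fract v) + (0, (⌊v⌋ : ℝ)) := by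
    simp
  rw [h2, ← fderiv_comp_add_right, hper]
  exact h1

end SmoothPer

namespace IsShearFlow

variable {G : Param d → Plane → ℝ} {u : ℝ → Param d × Plane → ℝ} (hu : IsShearFlow G u)
include hu

theorem zero (ζ : Param d × Plane) : u 0 ζ = 0 := IsScalarFlow.zero hu ζ

theorem ode (μ : Param d) (z : Plane) (t : ℝ) :
    HasDerivAt (fun s => u s (μ, z)) (G μ (slide (u t (μ, z)) z)) t :=
  IsScalarFlow.ode hu (μ, z) t

theorem contDiff : ContDiff ℝ ∞ fun w : ℝ × Param d × Plane => u w.1 w.2 :=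
  IsScalarFlow.contDiff hu

theorem contDiff_at (t : ℝ) : ContDiff ℝ ∞ fun w : Param d × Plane => u t w := by
  have h1 : ContDiff ℝ ∞ fun w : Param d × Plane => (t, w) := by fun_prop
  exact hu.contDiff.comp h1

/-- Uniqueness of solutions; the periodicity of the displacement and the group law both follow from
it. -/
theorem eq_of_ode (hG : SmoothPer G) (μ : Param d) (z : Plane) {f : ℝ → ℝ} (h0 : f 0 = 0)
    (hf : ∀ t, HasDerivAt f (G μ (slide (f t) z)) t) (t : ℝ) : f t = u t (μ, z) := by
  obtain ⟨K, -, hK, -⟩ := hG.exists_lipschitzWith_slide μ z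
  have := ODE_solution_unique_univ (v := fun _ v => G μ (slide v z)) (s := fun _ => Set.univ)
    (t₀ := 0) (f := f) (g := fun s => u s (μ, z)) (fun _ => hK.lipschitzOnWith)
    (fun t => ⟨hf t, trivial⟩) (fun t => ⟨hu.ode μ z t, trivial⟩) (h0.trans (hu.zero _).symm)
  exact congrFun this t

theorem add_int (hG : SmoothPer G) (μ : Param d) (z : Plane) (a b : ℤ) (t : ℝ) :
    u t (μ, z + ((a : ℝ), (b : ℝ))) = u t (μ, z) := by
  refine hu.eq_of_ode hG μ z (f := fun s => u s (μ, z + ((a : ℝ), (b : ℝ)))) (hu.zero _) ?_ t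
  intro s
  have := hu.ode μ (z + ((a : ℝ), (b : ℝ))) s
  rwa [slide_add, (hG.per μ).add_int] at this

theorem smoothPer (hG : SmoothPer G) (t : ℝ) : SmoothPer fun μ z => u t (μ, z) :=
  ⟨hu.contDiff_at t, fun μ => isBiperiodic_of_add_int fun z a b => hu.add_int hG μ z a b t⟩

/-- The group property of the flow. -/
theorem add (hG : SmoothPer G) (μ : Param d) (z : Plane) (s t : ℝ) :
    u s (μ, z) + u t (μ, slide (u s (μ, z)) z) = u (t + s) (μ, z) := by
  have := hu.eq_of_ode hG μ (slide (u s (μ, z)) z)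
    (f := fun t => u (t + s) (μ, z) - u s (μ, z)) (by simp) (fun t => ?_) t
  · rw [← this]; ring
  · have h1 := ((hu.ode μ z (t + s)).comp_add_const t s).sub_const (u s (μ, z))
    rw [slide_slide]
    simpa using h1

theorem isFlowOf (μ : Param d) :
    IsFlowOf (shearField (G μ)) fun t z => slide (u t (μ, z)) z := by
  intro z
  refine ⟨by simp [hu.zero, slide_zero], fun t => ?_⟩
  exact ((hu.ode μ z t).const_add z.1).prodMk (hasDerivAt_const t z.2)

theorem slide_neg_slide (hG : SmoothPer G) (μ : Param d) (z : Plane) (t : ℝ) :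
    slide (u (-t) (μ, slide (u t (μ, z)) z)) (slide (u t (μ, z)) z) = z := by
  rw [slide_slide, hu.add hG]
  simp [hu.zero, slide_zero]

theorem isNearIdentity (hG : SmoothPer G) (j : ℕ)
    (hnear : ∃ C : ℝ, ∀ᶠ μ in nhds (0 : Param d), ∀ z : Plane, |u 1 (μ, z)| ≤ C * ‖μ‖ ^ j) :
    IsNearIdentity j fun μ z => slide (u 1 (μ, z)) z where
  contDiff := by
    have h1 : ContDiff ℝ ∞ fun w : Param d × Plane => (u 1 w, w.2) :=
      (hu.contDiff_at 1).prodMk contDiff_snd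
    exact contDiff_slide.comp h1
  diffeo μ := by
    refine ⟨fun z => slide (u (-1) (μ, z)) z, ?_, fun z => hu.slide_neg_slide hG μ z 1,
      fun z => ?_⟩
    · have h0 : ContDiff ℝ ∞ fun z : Plane => (μ, z) := by fun_prop
      have h1 : ContDiff ℝ ∞ fun z : Plane => (u (-1) (μ, z), z) :=
        ((hu.contDiff_at (-1)).comp h0).prodMk contDiff_id
      exact contDiff_slide.comp h1
    · simpa using hu.slide_neg_slide hG μ z (-1)
  lift μ z a b := by
    simp only [hu.add_int hG, slide_add]
  near := by
    obtain ⟨C, hC⟩ := hnear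
    refine ⟨C, hC.mono fun μ h z => ?_⟩
    have : slide (u 1 (μ, z)) z - z = (u 1 (μ, z), 0) := by
      simp [slide, Prod.ext_iff]
    rw [this]
    simpa using h z

end IsShearFlow

end ShearFlow

/-- Ensures that the quotients produced by Hadamard-type factorisations are again smooth. -/
theorem contDiff_meanFDeriv {H W : Type} [NormedAddCommGroup H] [NormedSpace ℝ H] [ProperSpace H]
    [NormedAddCommGroup W] [NormedSpace ℝ W] {Γ : H → W → ℝ} {w : H → W}
    (hΓ : ContDiff ℝ ∞ fun p : H × W => Γ p.1 p.2) (hw : ContDiff ℝ ∞ w) :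
    ContDiff ℝ ∞ fun x => meanFDeriv (Γ x) (w x) 0 := by
  unfold meanFDeriv
  refine contDiff_intervalIntegral (n := ⊤)
    (f := fun θ x => fderiv ℝ (Γ x) (0 + θ • (w x - 0))) 0 1 ?_
  have h1 : ContDiff ℝ ∞ (Function.uncurry fun (p : ℝ × H) (y : W) => Γ p.2 y) :=
    hΓ.comp (by fun_prop : ContDiff ℝ ∞ fun p : (ℝ × H) × W => (p.1.2, p.2))
  have h2 : ContDiff ℝ ∞ fun p : ℝ × H => (0 : W) + p.1 • (w p.2 - 0) := by fun_prop
  exact ContDiff.fderiv (m := ∞) h1 h2 (by simp)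

/-! ### Powers of the ideal generated by the parameters. -/

section Ideal

variable {d : ℕ}

/-- The partial derivative in `x`. -/
noncomputable def dX (S : Param d → Plane → ℝ) (μ : Param d) (z : Plane) : ℝ :=
  fderiv ℝ (S μ) z (1, 0)

/-- The partial derivative in `y`. -/
noncomputable def dY (S : Param d → Plane → ℝ) (μ : Param d) (z : Plane) : ℝ :=
  fderiv ℝ (S μ) z (0, 1)

theorem isBiperiodic_fderiv {h : Plane → ℝ} (hh : IsBiperiodic h) (v : Plane) :
    IsBiperiodic fun z => fderiv ℝ h z v := by
  refine isBiperiodic_of_add_int fun z a b => ?_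
  have : (fun z => h (z + ((a : ℝ), (b : ℝ)))) = h := funext fun z => hh.add_int z a b
  rw [← fderiv_comp_add_right, this]

namespace SmoothPer

variable {S T : Param d → Plane → ℝ}

theorem at_param (hS : SmoothPer S) (μ : Param d) : ContDiff ℝ ∞ (S μ) :=
  hS.smooth.comp (by fun_prop : ContDiff ℝ ∞ fun z : Plane => (μ, z))

theorem differentiable (hS : SmoothPer S) (μ : Param d) : Differentiable ℝ (S μ) :=
  (hS.at_param μ).differentiable (by simp)

theorem of_coeff {a : Plane → ℝ} (ha : ContDiff ℝ ∞ a) (hp : IsBiperiodic a) :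
    SmoothPer fun (_ : Param d) z => a z :=
  ⟨ha.comp contDiff_snd, fun _ => hp⟩

theorem of_param {c : Param d → ℝ} (hc : ContDiff ℝ ∞ c) : SmoothPer fun μ (_ : Plane) => c μ :=
  ⟨hc.comp contDiff_fst, fun _ _ _ => ⟨rfl, rfl⟩⟩

theorem const (c : ℝ) : SmoothPer fun (_ : Param d) (_ : Plane) => c := of_param contDiff_const

theorem comp₂ (hS : SmoothPer S) (hT : SmoothPer T) {F : ℝ → ℝ → ℝ}
    (hF : ContDiff ℝ ∞ fun w : Param d × Plane => F (S w.1 w.2) (T w.1 w.2)) :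
    SmoothPer fun μ z => F (S μ z) (T μ z) := by
  refine ⟨hF, fun μ x y => ?_⟩
  have h1 := hS.per μ x y
  have h2 := hT.per μ x y
  exact ⟨by rw [h1.1, h2.1], by rw [h1.2, h2.2]⟩

theorem add (hS : SmoothPer S) (hT : SmoothPer T) : SmoothPer fun μ z => S μ z + T μ z :=
  hS.comp₂ hT (F := fun a b => a + b) (hS.smooth.add hT.smooth)

theorem sub (hS : SmoothPer S) (hT : SmoothPer T) : SmoothPer fun μ z => S μ z - T μ z :=
  hS.comp₂ hT (F := fun a b => a - b) (hS.smooth.sub hT.smooth)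

theorem mul (hS : SmoothPer S) (hT : SmoothPer T) : SmoothPer fun μ z => S μ z * T μ z :=
  hS.comp₂ hT (F := fun a b => a * b) (hS.smooth.mul hT.smooth)

theorem div (hS : SmoothPer S) (hT : SmoothPer T) (h0 : ∀ μ z, T μ z ≠ 0) :
    SmoothPer fun μ z => S μ z / T μ z :=
  hS.comp₂ hT (F := fun a b => a / b) (hS.smooth.div hT.smooth fun w => h0 w.1 w.2)

theorem sum {ι : Type*} (s : Finset ι) {S : ι → Param d → Plane → ℝ}
    (hS : ∀ i ∈ s, SmoothPer (S i)) : SmoothPer fun μ z => ∑ i ∈ s, S i μ z := by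
  refine ⟨ContDiff.sum fun i hi => (hS i hi).smooth, fun μ x y => ?_⟩
  exact ⟨Finset.sum_congr rfl fun i hi => ((hS i hi).per μ x y).1,
    Finset.sum_congr rfl fun i hi => ((hS i hi).per μ x y).2⟩

theorem fderiv_apply (hS : SmoothPer S) (v : Plane) : SmoothPer fun μ z => fderiv ℝ (S μ) z v := by
  refine ⟨?_, fun μ => isBiperiodic_fderiv (hS.per μ) v⟩
  have h1 : ContDiff ℝ ∞ (Function.uncurry fun (w : Param d × Plane) (y : Plane) => S w.1 y) :=
    hS.smooth.comp (by fun_prop : ContDiff ℝ ∞ fun p : (Param d × Plane) × Plane => (p.1.1, p.2))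
  exact (ContDiff.fderiv (m := ∞) h1 contDiff_snd (by simp)).clm_apply contDiff_const

theorem dX (hS : SmoothPer S) : SmoothPer (dX S) := hS.fderiv_apply (1, 0)

theorem comp_slide (hS : SmoothPer S) {h : Param d → Plane → ℝ} (hh : SmoothPer h) :
    SmoothPer fun μ z => S μ (slide (h μ z) z) := by
  constructor
  · have h1 : ContDiff ℝ ∞ fun w : Param d × Plane => (w.1, slide (h w.1 w.2) w.2) :=
      contDiff_fst.prodMk (contDiff_slide.comp (hh.smooth.prodMk contDiff_snd))
    exact hS.smooth.comp h1
  · refine fun μ => isBiperiodic_of_add_int fun z a b => ?_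
    rw [(hh.per μ).add_int, slide_add, (hS.per μ).add_int]

theorem integral {S : ℝ → Param d → Plane → ℝ}
    (hS : ContDiff ℝ ∞ fun w : ℝ × Param d × Plane => S w.1 w.2.1 w.2.2)
    (hp : ∀ s μ, IsBiperiodic (S s μ)) : SmoothPer fun μ z => ∫ s in (0 : ℝ)..1, S s μ z := by
  constructor
  · exact contDiff_intervalIntegral (n := ⊤)
      (f := fun s (w : Param d × Plane) => S s w.1 w.2) 0 1 hS
  · intro μ x y
    exact ⟨by simp only [(hp _ μ x y).1], by simp only [(hp _ μ x y).2]⟩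

/-- A bound which is uniform in the phase and locally uniform in the parameters. -/
theorem exists_bound (hS : SmoothPer S) :
    ∃ C : ℝ, ∀ μ ∈ Metric.closedBall (0 : Param d) 1, ∀ z, |S μ z| ≤ C := by
  have hK : IsCompact (Metric.closedBall (0 : Param d) 1 ×ˢ
      (Set.Icc (0 : ℝ) 1 ×ˢ Set.Icc (0 : ℝ) 1)) :=
    (isCompact_closedBall 0 1).prod (isCompact_Icc.prod isCompact_Icc)
  obtain ⟨C, hC⟩ := hK.exists_bound_of_continuousOn hS.smooth.continuous.continuousOn
  refine ⟨C, fun μ hμ z => ?_⟩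
  obtain ⟨a, b, hab⟩ := exists_int_translate z
  rw [← (hS.per μ).add_int z a b]
  exact hC (μ, _) ⟨hμ, hab⟩

end SmoothPer

theorem hasDerivAt_slide {S : Param d → Plane → ℝ} (hS : SmoothPer S) (μ : Param d) (z : Plane)
    (v : ℝ) : HasDerivAt (fun v => S μ (slide v z)) (dX S μ (slide v z)) v := by
  have h1 : HasDerivAt (fun v : ℝ => slide v z) (1, 0) v :=
    ((hasDerivAt_id v).const_add z.1).prodMk (hasDerivAt_const v z.2)
  exact (hS.differentiable μ _).hasFDerivAt.comp_hasDerivAt v h1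

/-- The monomial `μ^m`. -/
def monomial (m : Fin d → ℕ) (μ : Param d) : ℝ := ∏ i, μ i ^ m i

theorem contDiff_monomial (m : Fin d → ℕ) : ContDiff ℝ ∞ (monomial m) := by
  unfold monomial; fun_prop

theorem monomial_add (m m' : Fin d → ℕ) (μ : Param d) :
    monomial (m + m') μ = monomial m μ * monomial m' μ := by
  simp [monomial, pow_add, Finset.prod_mul_distrib]

theorem abs_monomial_le (m : Fin d → ℕ) (μ : Param d) : |monomial m μ| ≤ ‖μ‖ ^ ∑ i, m i := by
  rw [monomial, Finset.abs_prod, ← Finset.prod_pow_eq_pow_sum]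
  refine Finset.prod_le_prod (fun _ _ => abs_nonneg _) fun i _ => ?_
  rw [abs_pow]
  exact pow_le_pow_left₀ (abs_nonneg _) (norm_le_pi_norm μ i) _

/-- `S` lies in the `k`-th power of the ideal generated by the parameters. -/
def Ord (k : ℕ) (S : Param d → Plane → ℝ) : Prop :=
  ∃ s : (Fin d → ℕ) → Param d → Plane → ℝ, (∀ m, SmoothPer (s m)) ∧
    ∀ μ z, S μ z = ∑ m ∈ Finset.Nat.antidiagonalTuple d k, monomial m μ * s m μ z

namespace Ord

variable {k l : ℕ} {S T : Param d → Plane → ℝ}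

theorem congr (hS : Ord k S) (h : ∀ μ z, T μ z = S μ z) : Ord k T := by
  have : T = S := by funext μ z; exact h μ z
  rwa [this]

theorem zero (k : ℕ) : Ord k fun (_ : Param d) (_ : Plane) => (0 : ℝ) :=
  ⟨fun _ _ _ => 0, fun _ => SmoothPer.const 0, by simp⟩

theorem add (hS : Ord k S) (hT : Ord k T) : Ord k fun μ z => S μ z + T μ z := by
  obtain ⟨s, hs, hS⟩ := hS
  obtain ⟨t, ht, hT⟩ := hT
  refine ⟨fun m μ z => s m μ z + t m μ z, fun m => (hs m).add (ht m), fun μ z => ?_⟩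
  simp only [hS, hT, mul_add, Finset.sum_add_distrib]

theorem mul_smooth (hS : Ord k S) (hT : SmoothPer T) : Ord k fun μ z => S μ z * T μ z := by
  obtain ⟨s, hs, hS⟩ := hS
  refine ⟨fun m μ z => s m μ z * T μ z, fun m => (hs m).mul hT, fun μ z => ?_⟩
  simp only [hS, Finset.sum_mul, mul_assoc]

theorem const_mul (hS : Ord k S) (c : ℝ) : Ord k fun μ z => c * S μ z :=
  (hS.mul_smooth (SmoothPer.const c)).congr fun _ _ => mul_comm _ _

theorem sub (hS : Ord k S) (hT : Ord k T) : Ord k fun μ z => S μ z - T μ z :=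
  (hS.add (hT.const_mul (-1))).congr fun _ _ => by ring

theorem sum {ι : Type*} (t : Finset ι) {S : ι → Param d → Plane → ℝ}
    (hS : ∀ i ∈ t, Ord k (S i)) : Ord k fun μ z => ∑ i ∈ t, S i μ z := by
  classical
  induction t using Finset.induction_on with
  | empty => simpa using zero k
  | insert i t hi ih =>
    simp only [Finset.sum_insert hi]
    exact (hS i (Finset.mem_insert_self i t)).add
      (ih fun j hj => hS j (Finset.mem_insert_of_mem hj))

theorem of_monomial {m : Fin d → ℕ} (hm : ∑ i, m i = k) (hT : SmoothPer T) :
    Ord k fun μ z => monomial m μ * T μ z := by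
  classical
  refine ⟨fun m' => if m' = m then T else fun _ _ => 0, fun m' => ?_, fun μ z => ?_⟩
  · dsimp only
    split_ifs
    exacts [hT, SmoothPer.const 0]
  · rw [Finset.sum_eq_single m]
    · simp
    · intro m' _ h
      simp [h]
    · intro h
      exact absurd (Finset.Nat.mem_antidiagonalTuple.2 hm) h

theorem smoothPer (hS : Ord k S) : SmoothPer S := by
  obtain ⟨s, hs, hS⟩ := hS
  have : S = fun μ z => ∑ m ∈ Finset.Nat.antidiagonalTuple d k, monomial m μ * s m μ z := by
    funext μ z; exact hS μ z
  rw [this]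
  exact SmoothPer.sum _ fun m _ => (SmoothPer.of_param (contDiff_monomial m)).mul (hs m)

/-- To show that a linear image of `S` is in the ideal it is enough to look at the terms. -/
theorem of_terms {L : (Param d → Plane → ℝ) → Param d → Plane → ℝ} (hS : Ord k S)
    (hL : ∀ s : (Fin d → ℕ) → Param d → Plane → ℝ, (∀ m, SmoothPer (s m)) → ∀ μ z,
      L (fun μ z => ∑ m ∈ Finset.Nat.antidiagonalTuple d k, monomial m μ * s m μ z) μ z =
        ∑ m ∈ Finset.Nat.antidiagonalTuple d k, monomial m μ * L (s m) μ z)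
    (hs : ∀ s, SmoothPer s → Ord l (L s)) : Ord (k + l) (L S) := by
  obtain ⟨s, hs', hS⟩ := hS
  have e : S = fun μ z => ∑ m ∈ Finset.Nat.antidiagonalTuple d k, monomial m μ * s m μ z := by
    funext μ z; exact hS μ z
  rw [e]
  refine (sum (Finset.Nat.antidiagonalTuple d k)
    (S := fun m μ z => monomial m μ * L (s m) μ z) fun m hm => ?_).congr (hL s hs')
  obtain ⟨t, ht, hT⟩ := hs (s m) (hs' m)
  refine (sum (Finset.Nat.antidiagonalTuple d l)
    (S := fun m' μ z => monomial (m + m') μ * t m' μ z) fun m' hm' => ?_).congr fun μ z => ?_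
  · refine of_monomial ?_ (ht m')
    simp only [Pi.add_apply, Finset.sum_add_distrib]
    rw [Finset.Nat.mem_antidiagonalTuple.1 hm, Finset.Nat.mem_antidiagonalTuple.1 hm']
  · rw [hT, Finset.mul_sum]
    exact Finset.sum_congr rfl fun m' _ => by rw [monomial_add]; ring

theorem of_smoothPer (hS : SmoothPer S) : Ord 0 S :=
  (of_monomial (m := 0) (by simp) hS).congr fun μ z => by simp [monomial]

theorem mul (hS : Ord k S) (hT : Ord l T) : Ord (k + l) fun μ z => S μ z * T μ z := by
  refine of_terms (L := fun S μ z => S μ z * T μ z) hS (fun s _ μ z => ?_) fun s hs => ?_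
  · rw [Finset.sum_mul]
    simp only [mul_assoc]
  · exact (hT.mul_smooth hs).congr fun _ _ => mul_comm _ _

/-- One parameter is split off each monomial of degree `k + 1` and moved into its smooth
coefficient. -/
theorem pred (hS : Ord (k + 1) S) : Ord k S := by
  obtain ⟨s, hs, hS⟩ := hS
  refine (sum (Finset.Nat.antidiagonalTuple d (k + 1))
    (S := fun m μ z => monomial m μ * s m μ z) fun m hm => ?_).congr hS
  have hm := Finset.Nat.mem_antidiagonalTuple.1 hm
  obtain ⟨i, -, hi⟩ : ∃ i ∈ Finset.univ, m i ≠ 0 := by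
    refine Finset.exists_ne_zero_of_sum_ne_zero (f := m) ?_
    omega
  have hsplit : m = (m - Pi.single i 1) + Pi.single i 1 := by
    funext j
    by_cases h : j = i
    · subst h; simp; omega
    · simp [h]
  have hsum : ∑ j, (m - Pi.single i 1 : Fin d → ℕ) j = k := by
    have : ∑ j, m j = ∑ j, (m - Pi.single i 1 : Fin d → ℕ) j + 1 := by
      conv_lhs => rw [hsplit]
      simp [Finset.sum_add_distrib]
    omega
  refine (of_monomial hsum ((SmoothPer.of_param (contDiff_monomial (Pi.single i 1))).mul
    (hs m))).congr fun μ z => ?_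
  have e : monomial m μ = monomial (m - Pi.single i 1) μ * monomial (Pi.single i 1) μ := by
    rw [← monomial_add, ← hsplit]
  rw [e, mul_assoc]

theorem mono (hS : Ord k S) (h : l ≤ k) : Ord l S := by
  induction k, h using Nat.le_induction with
  | base => exact hS
  | succ k _ ih => exact ih hS.pred

/-- Phase derivatives treat the monomials in `μ` as constants, so no order is lost. -/
theorem fderiv_apply (hS : Ord k S) (v : Plane) : Ord k fun μ z => fderiv ℝ (S μ) z v := by
  refine of_terms (l := 0) (L := fun S μ z => fderiv ℝ (S μ) z v) hS (fun s hs μ z => ?_)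
    fun s hs => of_smoothPer (hs.fderiv_apply v)
  rw [fderiv_fun_sum fun m _ => ((hs m).differentiable μ z).const_mul _]
  simp only [FunLike.coe_sum, Finset.sum_apply]
  refine Finset.sum_congr rfl fun m _ => ?_
  rw [fderiv_const_mul ((hs m).differentiable μ z)]
  simp

theorem dX (hS : Ord k S) : Ord k (dX S) := hS.fderiv_apply (1, 0)

theorem dY (hS : Ord k S) : Ord k (dY S) := hS.fderiv_apply (0, 1)

theorem comp_slide (hS : Ord k S) {h : Param d → Plane → ℝ} (hh : SmoothPer h) :
    Ord k fun μ z => S μ (slide (h μ z) z) :=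
  of_terms (l := 0) (L := fun S μ z => S μ (slide (h μ z) z)) hS (fun _ _ _ _ => rfl)
    fun _ hs => of_smoothPer (hs.comp_slide hh)

/-- By the mean value factorisation in `x`, the difference is `h` times a smooth biperiodic family.
-/
theorem comp_slide_sub_of_smoothPer (hS : SmoothPer S) {h : Param d → Plane → ℝ} (hh : Ord l h) :
    Ord l fun μ z => S μ (slide (h μ z) z) - S μ z := by
  have hsm : SmoothPer fun μ z => meanFDeriv (fun v => S μ (slide v z)) (h μ z) 0 1 := by
    constructor
    · exact (contDiff_meanFDeriv (Γ := fun (w : Param d × Plane) v => S w.1 (slide v w.2))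
        (w := fun w => h w.1 w.2) hS.smooth_shear hh.smoothPer.smooth).clm_apply contDiff_const
    · refine fun μ => isBiperiodic_of_add_int fun z a b => ?_
      simp only [slide_add, (hh.smoothPer.per μ).add_int, (hS.per μ).add_int]
  refine (hh.mul_smooth hsm).congr fun μ z => ?_
  have := meanFDeriv_apply_sub ((hS.smooth_slide μ z).of_le (by norm_cast)) (h μ z) 0
  rw [slide_zero] at this
  rw [← this, ← smul_eq_mul, ← map_smul]
  simp

theorem comp_slide_sub (hS : Ord k S) {h : Param d → Plane → ℝ} (hh : Ord l h) :
    Ord (k + l) fun μ z => S μ (slide (h μ z) z) - S μ z := by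
  refine of_terms (L := fun S μ z => S μ (slide (h μ z) z) - S μ z) hS (fun s _ μ z => ?_)
    fun s hs => comp_slide_sub_of_smoothPer hs hh
  simp only [mul_sub, Finset.sum_sub_distrib]

/-- Hadamard's lemma. -/
theorem sub_at_zero (hS : SmoothPer S) : Ord 1 fun μ z => S μ z - S 0 z := by
  have hsm : ∀ i : Fin d, SmoothPer fun μ z =>
      meanFDeriv (fun ν => S ν z) μ 0 (Pi.single i 1) := by
    intro i
    constructor
    · have h1 : ContDiff ℝ ∞ fun p : (Param d × Plane) × Param d => S p.2 p.1.2 :=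
        hS.smooth.comp
          (by fun_prop : ContDiff ℝ ∞ fun p : (Param d × Plane) × Param d => (p.2, p.1.2))
      exact (contDiff_meanFDeriv (Γ := fun (w : Param d × Plane) ν => S ν w.2)
        (w := fun w => w.1) h1 contDiff_fst).clm_apply contDiff_const
    · refine fun μ => isBiperiodic_of_add_int fun z a b => ?_
      simp only [(hS.per _).add_int]
  refine (sum Finset.univ (S := fun (i : Fin d) μ z => monomial (Pi.single i 1) μ *
    meanFDeriv (fun ν => S ν z) μ 0 (Pi.single i 1)) fun i _ =>
      of_monomial (by simp) (hsm i)).congr fun μ z => ?_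
  have h1 : ContDiff ℝ 1 fun ν => S ν z :=
    (hS.smooth.comp (by fun_prop : ContDiff ℝ ∞ fun ν : Param d => (ν, z))).of_le (by norm_cast)
  rw [← meanFDeriv_apply_sub h1 μ 0, sub_zero]
  conv_lhs => rw [← Finset.univ_sum_single μ, map_sum]
  refine Finset.sum_congr rfl fun i _ => ?_
  have h2 : monomial (Pi.single i 1) μ = μ i := by
    rw [monomial, Finset.prod_eq_single i]
    · simp
    · intro j _ h; simp [h]
    · simp
  have h3 : (Pi.single i (μ i) : Param d) = μ i • Pi.single i 1 := by
    rw [← Pi.single_smul]; simp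
  rw [h2, h3, map_smul, smul_eq_mul, Finset.univ_sum_single]

/-- The leading homogeneous part. -/
theorem exists_sub_homPart (hS : Ord k S) :
    ∃ r : (Fin d → ℕ) → Plane → ℝ, (∀ m, ContDiff ℝ ∞ (r m) ∧ IsBiperiodic (r m)) ∧
      Ord (k + 1) fun μ z => S μ z - homPart r k μ z := by
  obtain ⟨s, hs, hS⟩ := hS
  -- Freezing the coefficients at `μ = 0` costs one more order, by Hadamard's lemma.
  refine ⟨fun m => s m 0, fun m => ⟨(hs m).at_param 0, (hs m).per 0⟩, ?_⟩
  refine (sum (Finset.Nat.antidiagonalTuple d k)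
    (S := fun m μ z => monomial m μ * 1 * (s m μ z - s m 0 z)) fun m hm => ?_).congr fun μ z => ?_
  · exact (of_monomial (Finset.Nat.mem_antidiagonalTuple.1 hm) (SmoothPer.const 1)).mul
      (sub_at_zero (hs m))
  · rw [hS, homPart, ← Finset.sum_sub_distrib]
    exact Finset.sum_congr rfl fun m _ => by rw [monomial]; ring

theorem of_homPart {r : (Fin d → ℕ) → Plane → ℝ} (k : ℕ)
    (hr : ∀ m, ContDiff ℝ ∞ (r m) ∧ IsBiperiodic (r m)) : Ord k (homPart r k) :=
  ⟨fun m _ => r m, fun m => SmoothPer.of_coeff (hr m).1 (hr m).2, fun _ _ => rfl⟩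

/-- Converts membership in the ideal into the analytic estimate `O(|μ|^k)`, uniformly in the phase.
-/
theorem exists_bound (hS : Ord k S) :
    ∃ C : ℝ, ∀ᶠ μ in nhds (0 : Param d), ∀ z, |S μ z| ≤ C * ‖μ‖ ^ k := by
  obtain ⟨s, hs, hS⟩ := hS
  choose C hC using fun m => (hs m).exists_bound
  refine ⟨∑ m ∈ Finset.Nat.antidiagonalTuple d k, C m, ?_⟩
  filter_upwards [Metric.closedBall_mem_nhds (0 : Param d) one_pos] with μ hμ z
  rw [hS, Finset.sum_mul]
  refine (Finset.abs_sum_le_sum_abs _ _).trans (Finset.sum_le_sum fun m hm => ?_)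
  rw [abs_mul, mul_comm]
  have h1 := abs_monomial_le m μ
  rw [Finset.Nat.mem_antidiagonalTuple.1 hm] at h1
  have h2 := hC m μ hμ z
  gcongr
  exact (abs_nonneg _).trans h2

end Ord

end Ideal

/-! ### Order of the time-one displacement. -/

section Displacement

variable {d : ℕ} {G : Param d → Plane → ℝ} {u : ℝ → Param d × Plane → ℝ}

theorem IsShearFlow.contDiff_comp (hu : IsShearFlow G u) {S : Param d → Plane → ℝ}
    (hS : SmoothPer S) :
    ContDiff ℝ ∞ fun w : ℝ × Param d × Plane => S w.2.1 (slide (u w.1 w.2) w.2.2) := by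
  have h1 : ContDiff ℝ ∞ fun w : ℝ × Param d × Plane => (w.2.1, slide (u w.1 w.2) w.2.2) :=
    contDiff_snd.fst.prodMk (contDiff_slide.comp (hu.contDiff.prodMk contDiff_snd.snd))
  exact hS.smooth.comp h1

theorem IsShearFlow.continuous_comp (hu : IsShearFlow G u) {S : Param d → Plane → ℝ}
    (hS : SmoothPer S) (μ : Param d) (z : Plane) :
    Continuous fun s => S μ (slide (u s (μ, z)) z) :=
  (hu.contDiff_comp hS).continuous.comp (by fun_prop : Continuous fun s : ℝ => (s, μ, z))

/-- Weighted time averages along the flow respect the powers of the parameter ideal. -/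
theorem Ord.integral_flow {k : ℕ} {T : Param d → Plane → ℝ} (hT : Ord k T)
    (hG : SmoothPer G) (hu : IsShearFlow G u) {w : ℝ → ℝ} (hw : ContDiff ℝ ∞ w) :
    Ord k fun μ z => ∫ s in (0 : ℝ)..1, w s * T μ (slide (u s (μ, z)) z) := by
  refine of_terms (l := 0)
    (L := fun T μ z => ∫ s in (0 : ℝ)..1, w s * T μ (slide (u s (μ, z)) z)) hT
    (fun t ht μ z => ?_) fun t ht => of_smoothPer ?_
  · have hc : ∀ m, Continuous fun s => t m μ (slide (u s (μ, z)) z) := fun m =>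
      hu.continuous_comp (ht m) μ z
    have hwc := hw.continuous
    simp only [Finset.mul_sum, ← intervalIntegral.integral_const_mul]
    have hi : ∀ m ∈ Finset.Nat.antidiagonalTuple d k, IntervalIntegrable
        (fun s => w s * (monomial m μ * t m μ (slide (u s (μ, z)) z)))
        MeasureTheory.volume 0 1 := fun m _ =>
      (hwc.mul (continuous_const.mul (hc m))).intervalIntegrable _ _
    rw [intervalIntegral.integral_finsetSum hi]
    exact Finset.sum_congr rfl fun m _ =>
      intervalIntegral.integral_congr fun s _ => by ring
  · refine SmoothPer.integral (S := fun s μ z => w s * t μ (slide (u s (μ, z)) z))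
      ((hw.comp contDiff_fst).mul (hu.contDiff_comp ht)) fun s μ =>
        isBiperiodic_of_add_int fun z a b => ?_
    rw [hu.add_int hG, slide_add, (ht.per μ).add_int]

/-- The factor `1` is the weight required by `Ord.integral_flow`. -/
theorem IsShearFlow.displacement_eq (hu : IsShearFlow G u) (hG : SmoothPer G) (μ : Param d)
    (z : Plane) : u 1 (μ, z) = ∫ s in (0 : ℝ)..1, 1 * G μ (slide (u s (μ, z)) z) := by
  simp only [one_mul]
  rw [intervalIntegral.integral_eq_sub_of_hasDerivAt (fun t _ => hu.ode μ z t)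
    ((hu.continuous_comp hG μ z).intervalIntegrable _ _), hu.zero, sub_zero]

/-- Taylor's formula in time with integral remainder: the second time derivative of the displacement
is `dX G * G` along the flow, hence of twice the order of `G`. -/
theorem IsShearFlow.displacement_sub_eq (hu : IsShearFlow G u) (hG : SmoothPer G) (μ : Param d)
    (z : Plane) : u 1 (μ, z) - G μ z = ∫ s in (0 : ℝ)..1,
      (1 - s) * (dX G μ (slide (u s (μ, z)) z) * G μ (slide (u s (μ, z)) z)) := by
  have hc1 := hu.continuous_comp hG μ z
  have hc2 := hu.continuous_comp hG.dX μ z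
  have hd : ∀ t ∈ Set.uIcc (0 : ℝ) 1, HasDerivAt
      (fun s => (1 - s) * G μ (slide (u s (μ, z)) z) + u s (μ, z))
      ((1 - t) * (dX G μ (slide (u t (μ, z)) z) * G μ (slide (u t (μ, z)) z))) t := by
    intro t _
    have h1 := (hasDerivAt_slide hG μ z (u t (μ, z))).comp t (hu.ode μ z t)
    have h2 := (((hasDerivAt_id t).const_sub 1).mul h1).add (hu.ode μ z t)
    refine h2.congr_deriv ?_
    simp
  rw [intervalIntegral.integral_eq_sub_of_hasDerivAt hd
    (((continuous_const.sub continuous_id).mul (hc2.mul hc1)).intervalIntegrable _ _)]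
  simp [hu.zero, slide_zero]

theorem IsShearFlow.ord_displacement (hu : IsShearFlow G u) {k : ℕ} (hG : Ord k G) :
    Ord k fun μ z => u 1 (μ, z) :=
  (hG.integral_flow hG.smoothPer hu contDiff_const).congr
    (hu.displacement_eq hG.smoothPer)

theorem IsShearFlow.ord_displacement_sub (hu : IsShearFlow G u) {k : ℕ} (hG : Ord k G) :
    Ord (k + k) fun μ z => u 1 (μ, z) - G μ z :=
  ((hG.dX.mul hG).integral_flow hG.smoothPer hu (contDiff_const.sub contDiff_id)).congr
    (hu.displacement_sub_eq hG.smoothPer)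

end Displacement

/-! ### Averaging over closed orbits and the homological equation. -/

section Averaging

variable (p q : ℤ) (r : Plane → ℝ)

/-- The mean of `r` over the closed orbits of `p ∂_x + q ∂_y` on the torus. -/
noncomputable def orbitMean (z : Plane) : ℝ :=
  ∫ s in (0 : ℝ)..1, r (z + s • ((p : ℝ), (q : ℝ)))

/-- A solution `g` of `(p / q ∂_x + ∂_y) g = r - orbitMean p q r`. -/
noncomputable def orbitPrimitive (z : Plane) : ℝ :=
  q * ∫ s in (0 : ℝ)..1, s * r (z + s • ((p : ℝ), (q : ℝ)))

variable {r}

theorem contDiff_orbitMean (hr : ContDiff ℝ ∞ r) : ContDiff ℝ ∞ (orbitMean p q r) := by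
  refine contDiff_intervalIntegral (n := ⊤) (f := fun s z => r (z + s • ((p : ℝ), (q : ℝ)))) 0 1 ?_
  exact hr.comp
    (by fun_prop : ContDiff ℝ ∞ fun w : ℝ × Plane => w.2 + w.1 • ((p : ℝ), (q : ℝ)))

theorem contDiff_orbitPrimitive (hr : ContDiff ℝ ∞ r) :
    ContDiff ℝ ∞ (orbitPrimitive p q r) := by
  refine contDiff_const.mul (contDiff_intervalIntegral (n := ⊤)
    (f := fun s z => s * r (z + s • ((p : ℝ), (q : ℝ)))) 0 1 ?_)
  exact contDiff_fst.mul (hr.comp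
    (by fun_prop : ContDiff ℝ ∞ fun w : ℝ × Plane => w.2 + w.1 • ((p : ℝ), (q : ℝ))))

theorem isBiperiodic_orbitMean (hr : IsBiperiodic r) : IsBiperiodic (orbitMean p q r) :=
  isBiperiodic_of_add_int fun z a b => by
    simp only [orbitMean, add_right_comm z _, hr.add_int]

theorem isBiperiodic_orbitPrimitive (hr : IsBiperiodic r) :
    IsBiperiodic (orbitPrimitive p q r) :=
  isBiperiodic_of_add_int fun z a b => by
    simp only [orbitPrimitive, add_right_comm z _, hr.add_int]

/-- As `(p, q)` is an integer vector, `r` is 1-periodic in time along the orbit, and the integral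
over a full period does not depend on where it starts. -/
theorem orbitMean_add_smul (hr : IsBiperiodic r) (z : Plane) (t : ℝ) :
    orbitMean p q r (z + t • ((p : ℝ), (q : ℝ))) = orbitMean p q r z := by
  have hper : Function.Periodic (fun s : ℝ => r (z + s • ((p : ℝ), (q : ℝ)))) 1 := fun s => by
    simp only [add_smul, one_smul, ← add_assoc, hr.add_int]
  have h1 := hper.intervalIntegral_add_eq t 0
  have h2 := intervalIntegral.integral_comp_add_left (a := 0) (b := 1)
    (fun s : ℝ => r (z + s • ((p : ℝ), (q : ℝ)))) t
  simp only [add_zero, zero_add] at h1 h2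
  rw [orbitMean, orbitMean, ← h1, ← h2]
  simp only [add_smul, add_assoc]

/-- With `v = (p, q)`, integrate the derivative of `s * r (z + s • v)` over `[0, 1]`: the boundary
term is `r (z + v) = r z`. The prefactor `q` in the primitive compensates for `(p / q, 1) = q⁻¹ •
v`. -/
theorem fderiv_orbitPrimitive (hq : q ≠ 0) (hr : ContDiff ℝ ∞ r) (hp : IsBiperiodic r)
    (z : Plane) :
    fderiv ℝ (orbitPrimitive p q r) z ((p : ℝ) / q, 1) = r z - orbitMean p q r z := by
  set v : Plane := ((p : ℝ), (q : ℝ)) with hv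
  have hq' : (q : ℝ) ≠ 0 := by exact_mod_cast hq
  have hr1 : Differentiable ℝ r := hr.differentiable (by simp)
  have hrc := hr.continuous
  have hrd : Continuous (fderiv ℝ r) := hr.continuous_fderiv (by simp)
  have hD : HasFDerivAt (fun z => ∫ s in (0 : ℝ)..1, s * r (z + s • v))
      (∫ s in (0 : ℝ)..1, s • fderiv ℝ r (z + s • v)) z := by
    refine hasFDerivAt_intervalIntegral_param (f := fun s z => s * r (z + s • v))
      (f' := fun s z => s • fderiv ℝ r (z + s • v)) 0 1 (by fun_prop) (by fun_prop) ?_ z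
    intro s x
    have h1 := (hr1 (x + s • v)).hasFDerivAt.comp x ((hasFDerivAt_id x).add_const (s • v))
    exact h1.const_mul s
  have hderiv : ∀ s ∈ Set.uIcc (0 : ℝ) 1, HasDerivAt (fun s : ℝ => s * r (z + s • v))
      (r (z + s • v) + s * fderiv ℝ r (z + s • v) v) s := by
    intro s _
    have h1 : HasDerivAt (fun s : ℝ => z + s • v) v s := by
      simpa using ((hasDerivAt_id s).smul_const v).const_add z
    have h2 := (hr1 (z + s • v)).hasFDerivAt.comp_hasDerivAt s h1
    refine ((hasDerivAt_id s).mul h2).congr_deriv ?_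
    simp
  have hI := intervalIntegral.integral_eq_sub_of_hasDerivAt hderiv
    (Continuous.intervalIntegrable (by fun_prop) _ _)
  rw [intervalIntegral.integral_add (Continuous.intervalIntegrable (by fun_prop) _ _)
    (Continuous.intervalIntegrable (by fun_prop) _ _)] at hI
  have hz : r (z + (1 : ℝ) • v) = r z := by rw [one_smul]; exact hp.add_int z p q
  rw [hz] at hI
  have hw : (((p : ℝ) / q, 1) : Plane) = (q : ℝ)⁻¹ • v := by
    rw [hv, Prod.smul_mk, smul_eq_mul, smul_eq_mul, inv_mul_cancel₀ hq', div_eq_inv_mul]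
  have hg : HasFDerivAt (orbitPrimitive p q r)
      ((q : ℝ) • ∫ s in (0 : ℝ)..1, s • fderiv ℝ r (z + s • v)) z := hD.const_mul (q : ℝ)
  have hi : IntervalIntegrable (fun s : ℝ => s • fderiv ℝ r (z + s • v)) MeasureTheory.volume 0 1 :=
    Continuous.intervalIntegrable (by fun_prop) _ _
  rw [hg.fderiv, hw, map_smul, smul_apply, smul_smul, inv_mul_cancel₀ hq', one_smul,
    ContinuousLinearMap.intervalIntegral_apply hi]
  simp only [smul_apply, smul_eq_mul]
  rw [orbitMean, ← hv]
  linarith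

end Averaging

/-! ### Pullback of vector fields by maps `(x, y) ↦ (x + h, y)`. -/

section Pullback

theorem hasFDerivAt_slide {h : Plane → ℝ} {z : Plane} (hh : DifferentiableAt ℝ h z) :
    HasFDerivAt (fun z => slide (h z) z) (((ContinuousLinearMap.fst ℝ ℝ ℝ) + fderiv ℝ h z).prod
      (ContinuousLinearMap.snd ℝ ℝ ℝ)) z :=
  (hasFDerivAt_fst.add hh.hasFDerivAt).prodMk hasFDerivAt_snd

variable {h : Plane → ℝ} {χ : Plane → Plane}

/-- The Jacobian matrix is triangular with diagonal `1 + h_x`, `1`. Invertibility of the map forces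
`1 + h_x ≠ 0` without any smallness of `h`, and the pullback solves a triangular linear system. -/
theorem one_add_fderiv_ne_zero_and_pullback_slide (hh : Differentiable ℝ h)
    (hχ : Differentiable ℝ χ)
    (hl : Function.LeftInverse χ fun z => slide (h z) z)
    (hr : Function.RightInverse χ fun z => slide (h z) z) (z : Plane) :
    1 + fderiv ℝ h z (1, 0) ≠ 0 ∧ ∀ f : Plane → ℝ,
      VectorField.pullback ℝ (fun z => slide (h z) z) (fun z => (f z, 1)) z =
        ((f (slide (h z) z) - fderiv ℝ h z (0, 1)) / (1 + fderiv ℝ h z (1, 0)), 1) := by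
  have hA := hasFDerivAt_slide (hh z)
  set A : Plane →L[ℝ] Plane := ((ContinuousLinearMap.fst ℝ ℝ ℝ) + fderiv ℝ h z).prod
      (ContinuousLinearMap.snd ℝ ℝ ℝ) with hAdef
  have hB := (hχ (slide (h z) z)).hasFDerivAt
  set B := fderiv ℝ χ (slide (h z) z)
  have hBA : B ∘L A = .id ℝ Plane := by
    have h1 := HasFDerivAt.comp (f := fun z => slide (h z) z) z hB hA
    have h2 : (χ ∘ fun z => slide (h z) z) = id := funext hl
    rw [h2] at h1
    exact h1.unique (hasFDerivAt_id z)
  have hAB : A ∘L B = .id ℝ Plane := by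
    have h1 : HasFDerivAt ((fun z => slide (h z) z) ∘ χ) (A ∘L B) (slide (h z) z) := by
      refine HasFDerivAt.comp _ ?_ hB
      have h0 : χ (slide (h z) z) = z := hl z
      rw [h0]
      exact hA
    have h2 : ((fun z => slide (h z) z) ∘ χ) = id := funext hr
    rw [h2] at h1
    exact h1.unique (hasFDerivAt_id _)
  have hBA' : ∀ w, B (A w) = w := fun w => DFunLike.congr_fun hBA w
  have hAw : ∀ w : Plane, A w = (w.1 + fderiv ℝ h z w, w.2) := fun w => rfl
  have hne : 1 + fderiv ℝ h z (1, 0) ≠ 0 := by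
    intro h0
    have h1 : A (1, 0) = 0 := by rw [hAw, h0]; rfl
    have h2 := hBA' (1, 0)
    rw [h1, map_zero] at h2
    simpa using congrArg Prod.fst h2
  refine ⟨hne, fun f => ?_⟩
  rw [VectorField.pullback, hA.fderiv, ContinuousLinearMap.inverse_eq hAB hBA]
  set c := (f (slide (h z) z) - fderiv ℝ h z (0, 1)) / (1 + fderiv ℝ h z (1, 0)) with hc
  have hv : ((c, 1) : Plane) = c • ((1, 0) : Plane) + (0, 1) := by simp
  have h1 : A (c, 1) = (f (slide (h z) z), 1) := by
    rw [hAw, Prod.mk.injEq]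
    refine ⟨?_, rfl⟩
    rw [hv, map_add, map_smul, smul_eq_mul]
    have : c * (1 + fderiv ℝ h z (1, 0)) = f (slide (h z) z) - fderiv ℝ h z (0, 1) := by
      rw [hc]; exact div_mul_cancel₀ _ hne
    simp only [Prod.fst_add, Prod.smul_fst, smul_eq_mul, mul_one, add_zero]
    linarith
  rw [← h1]
  exact hBA' _

end Pullback

section FlowPullback

variable {d : ℕ} {G : Param d → Plane → ℝ} {u : ℝ → Param d × Plane → ℝ}

theorem IsShearFlow.one_add_dX_ne_zero_and_pullback (hu : IsShearFlow G u) (hG : SmoothPer G)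
    (μ : Param d) (z : Plane) :
    1 + dX (fun μ z => u 1 (μ, z)) μ z ≠ 0 ∧ ∀ f : Plane → ℝ,
      VectorField.pullback ℝ (fun z => slide (u 1 (μ, z)) z) (fun z => (f z, 1)) z =
        ((f (slide (u 1 (μ, z)) z) - dY (fun μ z => u 1 (μ, z)) μ z) /
          (1 + dX (fun μ z => u 1 (μ, z)) μ z), 1) := by
  refine one_add_fderiv_ne_zero_and_pullback_slide (h := fun z => u 1 (μ, z))
    (χ := fun z => slide (u (-1) (μ, z)) z) ((hu.smoothPer hG 1).differentiable μ) ?_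
    (fun z => hu.slide_neg_slide hG μ z 1) (fun z => ?_) z
  · intro z
    exact (hasFDerivAt_slide ((hu.smoothPer hG (-1)).differentiable μ z)).differentiableAt
  · simpa using hu.slide_neg_slide hG μ z (-1)

end FlowPullback

/-! ### The normal form procedure. -/

section NormalForm

variable {d : ℕ}

theorem fderiv_homPart {g : (Fin d → ℕ) → Plane → ℝ} (hg : ∀ m, Differentiable ℝ (g m)) (k : ℕ)
    (μ : Param d) (z v : Plane) :
    fderiv ℝ (homPart g k μ) z v = homPart (fun m z => fderiv ℝ (g m) z v) k μ z := by
  unfold homPart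
  rw [fderiv_fun_sum fun m _ => (hg m z).const_mul _]
  simp only [FunLike.coe_sum, Finset.sum_apply]
  refine Finset.sum_congr rfl fun m _ => ?_
  rw [fderiv_const_mul (hg m z)]
  simp

theorem homPart_congr {a b : (Fin d → ℕ) → Plane → ℝ} {k : ℕ}
    (h : ∀ m, ∑ i, m i = k → a m = b m) : homPart a k = homPart b k := by
  funext μ z
  exact Finset.sum_congr rfl fun m hm => by rw [h m (Finset.Nat.mem_antidiagonalTuple.1 hm)]

theorem homPart_sub (a b : (Fin d → ℕ) → Plane → ℝ) (k : ℕ) (μ : Param d) (z : Plane) :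
    homPart (fun m z => a m z - b m z) k μ z = homPart a k μ z - homPart b k μ z := by
  simp only [homPart, mul_sub, Finset.sum_sub_distrib]

theorem homological_equation (p q : ℤ) (hq : q ≠ 0) {r : (Fin d → ℕ) → Plane → ℝ}
    (hr : ∀ m, ContDiff ℝ ∞ (r m) ∧ IsBiperiodic (r m)) (k : ℕ) (μ : Param d) (z : Plane) :
    (p : ℝ) / q * dX (homPart (fun m => orbitPrimitive p q (r m)) k) μ z +
      dY (homPart (fun m => orbitPrimitive p q (r m)) k) μ z =
    homPart r k μ z - homPart (fun m => orbitMean p q (r m)) k μ z := by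
  have hg : ∀ m, Differentiable ℝ (orbitPrimitive p q (r m)) := fun m =>
    (contDiff_orbitPrimitive p q (hr m).1).differentiable (by simp)
  have h1 := fderiv_homPart hg k μ z ((p : ℝ) / q, 1)
  have hv : (((p : ℝ) / q, 1) : Plane) = ((p : ℝ) / q) • ((1, 0) : Plane) + (0, 1) := by simp
  have h2 : homPart (fun m z => fderiv ℝ (orbitPrimitive p q (r m)) z ((p : ℝ) / q, 1)) k μ z =
      homPart (fun m z => r m z - orbitMean p q (r m) z) k μ z :=
    congrFun (congrFun (homPart_congr fun m _ => funext fun z =>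
      fderiv_orbitPrimitive p q hq (hr m).1 (hr m).2 z) μ) z
  rw [h2, homPart_sub, hv, map_add, map_smul, smul_eq_mul] at h1
  exact h1

/-- One step of the normal form procedure. -/
theorem exists_pullback_eq (p q : ℤ) (hq : q ≠ 0) {A R : Param d → Plane → ℝ} {j : ℕ} (hj : 1 ≤ j)
    (hA : Ord 1 A) (hR : Ord j R) {r : (Fin d → ℕ) → Plane → ℝ}
    (hr : ∀ m, ContDiff ℝ ∞ (r m) ∧ IsBiperiodic (r m))
    (hrR : Ord (j + 1) fun μ z => R μ z - homPart r j μ z)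
    {u : ℝ → Param d × Plane → ℝ}
    (hu : IsShearFlow (homPart (fun m => orbitPrimitive p q (r m)) j) u) :
    ∃ R', Ord (j + 1) R' ∧ ∀ μ, VectorField.pullback ℝ (fun z => slide (u 1 (μ, z)) z)
        (oscillatorField p q (fun μ z => A μ z + R μ z) μ) =
      oscillatorField p q
        (fun μ z => A μ z + homPart (fun m => orbitMean p q (r m)) j μ z + R' μ z) μ := by
  set G := homPart (fun m => orbitPrimitive p q (r m)) j with hGdef
  set a := homPart (fun m => orbitMean p q (r m)) j
  have hG : Ord j G := Ord.of_homPart j fun m =>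
    ⟨contDiff_orbitPrimitive p q (hr m).1, isBiperiodic_orbitPrimitive p q (hr m).2⟩
  have ha : Ord j a := Ord.of_homPart j fun m =>
    ⟨contDiff_orbitMean p q (hr m).1, isBiperiodic_orbitMean p q (hr m).2⟩
  set h : Param d → Plane → ℝ := fun μ z => u 1 (μ, z) with hh
  have hO : Ord j h := hu.ord_displacement hG
  have hD : Ord (j + j) fun μ z => h μ z - G μ z := hu.ord_displacement_sub hG
  have hne : ∀ μ z, 1 + dX h μ z ≠ 0 := fun μ z =>
    (hu.one_add_dX_ne_zero_and_pullback hG.smoothPer μ z).1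
  have hpb : ∀ μ z, ∀ f : Plane → ℝ,
      VectorField.pullback ℝ (fun z => slide (h μ z) z) (fun z => (f z, 1)) z =
        ((f (slide (h μ z) z) - dY h μ z) / (1 + dX h μ z), 1) :=
    fun μ z => (hu.one_add_dX_ne_zero_and_pullback hG.smoothPer μ z).2
  have hsub : ∀ μ z v, fderiv ℝ (fun z => h μ z - G μ z) z v =
      fderiv ℝ (h μ) z v - fderiv ℝ (G μ) z v := fun μ z v => by
    rw [fderiv_fun_sub (hO.smoothPer.differentiable μ z) (hG.smoothPer.differentiable μ z)]
    rfl
  -- This is the new remainder times `1 + dX h`. In degree `j` it reduces to the homological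
  -- equation for the leading part of `R`; everything else has order at least `j + 1`, where `1 ≤ j`
  -- is needed for the terms of order `j + j`.
  have hN : Ord (j + 1) fun μ z =>
      ((p : ℝ) / q + (A μ (slide (h μ z) z) + R μ (slide (h μ z) z)) - dY h μ z) -
        ((p : ℝ) / q + A μ z + a μ z) * (1 + dX h μ z) := by
    have e1 := (hA.comp_slide_sub hO).mono (l := j + 1) (by omega)
    have e2 := (hR.comp_slide_sub hO).mono (l := j + 1) (by omega)
    have e3 := (hD.dY).mono (l := j + 1) (by omega)
    have e4 := ((hD.dX).const_mul ((p : ℝ) / q)).mono (l := j + 1) (by omega)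
    have e5 := (hA.mul hO.dX).mono (l := j + 1) (by omega)
    have e6 := (ha.mul hO.dX).mono (l := j + 1) (by omega)
    refine ((((((e1.add e2).add hrR).sub e3).sub e4).sub e5).sub e6).congr fun μ z => ?_
    have hhom := homological_equation p q hq hr j μ z
    have hx : dX (fun μ z => h μ z - G μ z) μ z = dX h μ z - dX G μ z := hsub μ z (1, 0)
    have hy : dY (fun μ z => h μ z - G μ z) μ z = dY h μ z - dY G μ z := hsub μ z (0, 1)
    rw [hx, hy]
    linear_combination -hhom
  have h1 : SmoothPer fun μ z => 1 / (1 + dX h μ z) :=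
    (SmoothPer.const 1).div ((SmoothPer.const 1).add hO.smoothPer.dX) hne
  refine ⟨_, hN.mul_smooth h1, fun μ => funext fun z => ?_⟩
  refine (hpb μ z fun z => (p : ℝ) / q + (A μ z + R μ z)).trans ?_
  refine Prod.ext ?_ rfl
  have := hne μ z
  simp only [oscillatorField]
  field_simp
  ring

/-- The flow of `G μ ∂_x`, as a displacement. -/
noncomputable def shearFlow (G : Param d → Plane → ℝ) : ℝ → Param d × Plane → ℝ :=
  -- The choice depends on `G` only, so equal generators have equal flows. The default is never used
  -- for a `SmoothPer` family.
  open Classical in if h : ∃ u, IsShearFlow G u then h.choose else fun _ _ => 0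

theorem SmoothPer.isShearFlow {G : Param d → Plane → ℝ} (hG : SmoothPer G) :
    IsShearFlow G (shearFlow G) := by
  have h := hG.exists_shearFlow
  rw [shearFlow, dif_pos h]
  exact h.choose_spec

/-- The time-`t` map of the flow of the `j`-th generator. -/
noncomputable def generatorFlow (g : (Fin d → ℕ) → Plane → ℝ) (j : ℕ) (μ : Param d) (t : ℝ)
    (z : Plane) : Plane :=
  slide (shearFlow (homPart g j) t (μ, z)) z

theorem transformed_congr {ψ ψ' : ℕ → Param d → Plane → Plane} {X : Param d → Plane → Plane}
    {n : ℕ} (h : ∀ j ∈ Finset.Icc 1 n, ψ j = ψ' j) (μ : Param d) :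
    transformed ψ X n μ = transformed ψ' X n μ := by
  induction n with
  | zero => rfl
  | succ n ih =>
    simp only [transformed]
    rw [h (n + 1) (by simp), ih fun j hj => h j ?_]
    simp only [Finset.mem_Icc] at hj ⊢
    omega

/-- The transformations act for each `μ` separately, so a field may be replaced by another that
agrees with it only for `μ` near `0`. -/
theorem transformed_congr_field {ψ : ℕ → Param d → Plane → Plane} {X X' : Param d → Plane → Plane}
    {μ : Param d} (h : X μ = X' μ) (n : ℕ) : transformed ψ X n μ = transformed ψ X' n μ := by
  induction n with
  | zero => exact h
  | succ n ih => simp only [transformed, ih]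

/-- The normal form of order `n`. -/
theorem exists_normal_form (p q : ℤ) (hq : q ≠ 0) {F : Param d → Plane → ℝ} (hF : Ord 1 F)
    (n : ℕ) : ∃ g a : (Fin d → ℕ) → Plane → ℝ, ∃ R : Param d → Plane → ℝ,
      (∀ m, ContDiff ℝ ∞ (g m) ∧ IsBiperiodic (g m)) ∧
      (∀ m, ContDiff ℝ ∞ (a m) ∧ IsBiperiodic (a m)) ∧
      (∀ m z (t : ℝ), a m (z + t • ((p : ℝ), (q : ℝ))) = a m z) ∧
      (1 ≤ n → ∃ r : (Fin d → ℕ) → Plane → ℝ, (∀ m, ContDiff ℝ ∞ (r m) ∧ IsBiperiodic (r m)) ∧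
        (Ord 2 fun μ z => F μ z - homPart r 1 μ z) ∧
        ∀ m, ∑ i, m i = 1 → a m = orbitMean p q (r m)) ∧
      Ord (n + 1) R ∧
      ∀ μ, transformed (fun j μ => generatorFlow g j μ 1) (oscillatorField p q F) n μ =
        oscillatorField p q
          (fun μ z => (∑ j ∈ Finset.Icc 1 n, homPart a j μ z) + R μ z) μ := by
  induction n with
  | zero =>
    refine ⟨fun _ _ => 0, fun _ _ => 0, F, fun m => ⟨contDiff_const, fun _ _ => ⟨rfl, rfl⟩⟩,
      fun m => ⟨contDiff_const, fun _ _ => ⟨rfl, rfl⟩⟩, fun _ _ _ => rfl,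
      fun h => absurd h (by omega), hF, fun μ => ?_⟩
    simp [transformed]
  | succ n ih =>
    obtain ⟨g, a, R, hg, ha, hat, hdeg, hR, htr⟩ := ih
    obtain ⟨r, hr, hrR⟩ := hR.exists_sub_homPart
    -- A single array holds the generators of all degrees; overwriting the entries of degree `n + 1`
    -- leaves the earlier steps unchanged.
    set g' : (Fin d → ℕ) → Plane → ℝ := fun m =>
      if ∑ i, m i = n + 1 then orbitPrimitive p q (r m) else g m with hg'
    set a' : (Fin d → ℕ) → Plane → ℝ := fun m =>
      if ∑ i, m i = n + 1 then orbitMean p q (r m) else a m with ha'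
    have hgn : homPart g' (n + 1) = homPart (fun m => orbitPrimitive p q (r m)) (n + 1) :=
      homPart_congr fun m hm => if_pos hm
    have han : homPart a' (n + 1) = homPart (fun m => orbitMean p q (r m)) (n + 1) :=
      homPart_congr fun m hm => if_pos hm
    have hgo : ∀ j ∈ Finset.Icc 1 n, homPart g' j = homPart g j := fun j hj =>
      homPart_congr fun m hm => if_neg (by rw [Finset.mem_Icc] at hj; omega)
    have hao : ∀ j ∈ Finset.Icc 1 n, homPart a' j = homPart a j := fun j hj =>
      homPart_congr fun m hm => if_neg (by rw [Finset.mem_Icc] at hj; omega)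
    have hg's : ∀ m, ContDiff ℝ ∞ (g' m) ∧ IsBiperiodic (g' m) := fun m => by
      simp only [hg']
      split_ifs
      exacts [⟨contDiff_orbitPrimitive p q (hr m).1, isBiperiodic_orbitPrimitive p q (hr m).2⟩,
        hg m]
    have ha's : ∀ m, ContDiff ℝ ∞ (a' m) ∧ IsBiperiodic (a' m) := fun m => by
      simp only [ha']
      split_ifs
      exacts [⟨contDiff_orbitMean p q (hr m).1, isBiperiodic_orbitMean p q (hr m).2⟩, ha m]
    have hA : Ord 1 fun μ z => ∑ j ∈ Finset.Icc 1 n, homPart a j μ z :=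
      Ord.sum _ fun j hj => (Ord.of_homPart j ha).mono (Finset.mem_Icc.1 hj).1
    obtain ⟨R', hR', hpb⟩ := exists_pullback_eq p q hq (Nat.le_add_left 1 n) hA hR hr hrR
      (hgn ▸ (Ord.of_homPart (n + 1) hg's).smoothPer.isShearFlow)
    refine ⟨g', a', R', hg's, ha's, fun m z t => ?_, fun _ => ?_, hR', fun μ => ?_⟩
    · simp only [ha']
      split_ifs
      exacts [orbitMean_add_smul p q (hr m).2 z t, hat m z t]
    -- Before the first step the remainder is `F` itself, so the averaged terms of degree one come
    -- from the linear part of `F`. Later steps do not touch them.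
    · rcases Nat.eq_zero_or_pos n with rfl | hn
      · refine ⟨r, hr, ?_, fun m hm => if_pos (by simpa using hm)⟩
        have h0 := htr
        have hFR : ∀ μ z, F μ z = R μ z := fun μ z => by
          have := congrArg Prod.fst (congrFun (htr μ) z)
          simpa [transformed, oscillatorField] using this
        exact hrR.congr fun μ z => by rw [hFR]
      · obtain ⟨r₁, h1, h2, h3⟩ := hdeg hn
        refine ⟨r₁, h1, h2, fun m hm => ?_⟩
        rw [← h3 m hm]
        exact if_neg (by omega)
    · have hprev : transformed (fun j μ => generatorFlow g' j μ 1) (oscillatorField p q F) n μ =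
          oscillatorField p q
            (fun μ z => (∑ j ∈ Finset.Icc 1 n, homPart a j μ z) + R μ z) μ := by
        rw [← htr μ]
        refine transformed_congr (fun j hj => ?_) μ
        funext μ z
        simp only [generatorFlow, hgo j hj]
      simp only [transformed]
      rw [hprev]
      have hψ : generatorFlow g' (n + 1) μ 1 =
          fun z => slide (shearFlow (homPart g' (n + 1)) 1 (μ, z)) z := rfl
      rw [hψ, hgn]
      refine (hpb μ).trans ?_
      funext z
      simp only [oscillatorField]
      have hs : ∑ j ∈ Finset.Icc 1 n, homPart a' j μ z = ∑ j ∈ Finset.Icc 1 n, homPart a j μ z :=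
        Finset.sum_congr rfl fun j hj => by rw [hao j hj]
      rw [Finset.sum_Icc_succ_top (by omega), han, hs]

/-- A perturbation of order `k` of the vector field changes the transformed vector field only by
terms of order `k`. -/
theorem exists_transformed_add (p q : ℤ) {F S : Param d → Plane → ℝ} {k : ℕ} (hS : Ord k S)
    {g : (Fin d → ℕ) → Plane → ℝ} (hg : ∀ m, ContDiff ℝ ∞ (g m) ∧ IsBiperiodic (g m)) (n : ℕ) :
    ∃ F' S' : Param d → Plane → ℝ, Ord k S' ∧ ∀ μ,
      transformed (fun j μ => generatorFlow g j μ 1) (oscillatorField p q F) n μ =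
        oscillatorField p q F' μ ∧
      transformed (fun j μ => generatorFlow g j μ 1)
        (oscillatorField p q fun μ z => F μ z + S μ z) n μ =
        oscillatorField p q (fun μ z => F' μ z + S' μ z) μ := by
  induction n with
  | zero => exact ⟨F, S, hS, fun μ => ⟨rfl, rfl⟩⟩
  | succ n ih =>
    obtain ⟨F', S', hS', htr⟩ := ih
    have hG := (Ord.of_homPart (n + 1) hg).smoothPer
    have hu := hG.isShearFlow
    set h : Param d → Plane → ℝ := fun μ z => shearFlow (homPart g (n + 1)) 1 (μ, z) with hh
    have hsm : SmoothPer h := hu.smoothPer hG 1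
    have hne : ∀ μ z, 1 + dX h μ z ≠ 0 := fun μ z =>
      (hu.one_add_dX_ne_zero_and_pullback hG μ z).1
    have hpb : ∀ μ z, ∀ f : Plane → ℝ,
        VectorField.pullback ℝ (fun z => slide (h μ z) z) (fun z => (f z, 1)) z =
          ((f (slide (h μ z) z) - dY h μ z) / (1 + dX h μ z), 1) :=
      fun μ z => (hu.one_add_dX_ne_zero_and_pullback hG μ z).2
    have h1 : SmoothPer fun μ z => 1 / (1 + dX h μ z) :=
      (SmoothPer.const 1).div ((SmoothPer.const 1).add hsm.dX) hne
    -- The pullback is affine in the `x`-component, so the perturbation is simply composed with the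
    -- slide and divided by `1 + dX h`.
    refine ⟨fun μ z => ((p : ℝ) / q + F' μ (slide (h μ z) z) - dY h μ z) / (1 + dX h μ z) -
      (p : ℝ) / q, _, (hS'.comp_slide hsm).mul_smooth h1, fun μ => ⟨?_, ?_⟩⟩
    · simp only [transformed]
      rw [(htr μ).1]
      funext z
      refine (hpb μ z fun z => (p : ℝ) / q + F' μ z).trans (Prod.ext ?_ rfl)
      simp only [oscillatorField]
      ring
    · simp only [transformed]
      rw [(htr μ).2]
      funext z
      refine (hpb μ z fun z => (p : ℝ) / q + (F' μ z + S' μ z)).trans (Prod.ext ?_ rfl)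
      simp only [oscillatorField]
      have := hne μ z
      field_simp
      ring

end NormalForm

/-! ### Symmetry of higher derivatives. -/

section Symmetry

variable {E : Type} [NormedAddCommGroup E] [NormedSpace ℝ E] {G : E → ℝ}

/-- The iterated directional derivative along the vectors of a list. -/
noncomputable def listDeriv (G : E → ℝ) : List E → E → ℝ
  | [] => G
  | w :: l => fun x => fderiv ℝ (listDeriv G l) x w

theorem contDiff_listDeriv (hG : ContDiff ℝ ∞ G) (l : List E) : ContDiff ℝ ∞ (listDeriv G l) := by
  induction l with
  | nil => exact hG
  | cons w l ih => exact (ih.fderiv_right (m := ∞) (by simp)).clm_apply contDiff_const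

theorem fderiv_fderiv_comm (hG : ContDiff ℝ ∞ G) (v w x : E) :
    fderiv ℝ (fun y => fderiv ℝ G y v) x w = fderiv ℝ (fun y => fderiv ℝ G y w) x v := by
  have hd : DifferentiableAt ℝ (fderiv ℝ G) x :=
    (hG.fderiv_right (m := ∞) (by simp)).differentiable (by simp) x
  have hs : IsSymmSndFDerivAt ℝ G x :=
    hG.contDiffAt.isSymmSndFDerivAt (by
      rw [minSmoothness_of_isRCLikeNormedField]; exact WithTop.coe_le_coe.2 le_top)
  have h : ∀ v w : E, fderiv ℝ (fun y => fderiv ℝ G y v) x w = fderiv ℝ (fderiv ℝ G) x w v := by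
    intro v w
    rw [fderiv_clm_apply hd (differentiableAt_const v)]
    simp
  rw [h, h, hs.eq]

/-- Adjacent swaps generate all permutations, so the symmetry of second derivatives suffices. -/
theorem listDeriv_perm (hG : ContDiff ℝ ∞ G) {l l' : List E} (h : l.Perm l') :
    listDeriv G l = listDeriv G l' := by
  induction h with
  | nil => rfl
  | cons w _ ih => simp only [listDeriv, ih]
  | swap v w l =>
    funext x
    exact fderiv_fderiv_comm (contDiff_listDeriv hG l) v w x
  | trans _ _ ih₁ ih₂ => exact ih₁.trans ih₂

theorem iteratedFDeriv_eq_listDeriv (hG : ContDiff ℝ ∞ G) (n : ℕ) :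
    ∀ (v : Fin n → E) (x : E), iteratedFDeriv ℝ n G x v = listDeriv G (List.ofFn v) x := by
  induction n with
  | zero => intro v x; simp [listDeriv]
  | succ n ih =>
    intro v x
    have hd : DifferentiableAt ℝ (iteratedFDeriv ℝ n G) x :=
      hG.differentiable_iteratedFDeriv (by norm_cast; exact ENat.natCast_lt_top n) x
    rw [iteratedFDeriv_succ_apply_left, List.ofFn_succ]
    have h1 : listDeriv G (List.ofFn (Fin.tail v)) =
        fun y => iteratedFDeriv ℝ n G y (Fin.tail v) := by
      funext y; exact (ih _ y).symm
    have h2 := (hd.hasFDerivAt.continuousMultilinear_apply_const (Fin.tail v)).fderiv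
    change _ = fderiv ℝ (listDeriv G (List.ofFn (Fin.tail v))) x (v 0)
    rw [h1, h2]
    rfl

/-- Iterated derivatives of smooth functions are symmetric. -/
theorem iteratedFDeriv_comp_perm (hG : ContDiff ℝ ∞ G) {n : ℕ} (v : Fin n → E)
    (σ : Equiv.Perm (Fin n)) (x : E) :
    iteratedFDeriv ℝ n G x (v ∘ σ) = iteratedFDeriv ℝ n G x v := by
  rw [iteratedFDeriv_eq_listDeriv hG, iteratedFDeriv_eq_listDeriv hG,
    listDeriv_perm hG (σ.ofFn_comp_perm v)]

end Symmetry

/-! ### Taylor coefficients in the parameters and the ideal filtration. -/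

section Taylor

variable {d : ℕ}

/-- Sorts a word: `m` counts the letters and `σ` groups equal ones. This brings any tuple of basis
vectors into the order used by `taylorCoeff`. -/
theorem exists_fiber_counts {ι : Type} [Fintype ι] [DecidableEq ι] {n : ℕ}
    (v : Fin n → ι) : ∃ (m : ι → ℕ) (σ : (Σ i, Fin (m i)) ≃ Fin n),
      ∀ s, v (σ s) = s.1 := by
  refine ⟨fun i => Fintype.card {s // v s = i},
    (Equiv.sigmaCongrRight fun i => (Fintype.equivFin {s // v s = i}).symm).trans
      (Equiv.sigmaFiberEquiv v), ?_⟩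
  rintro ⟨i, s⟩
  exact ((Fintype.equivFin {s // v s = i}).symm s).2

/-- The `N`-th derivative vanishes if all Taylor coefficients of degree `N` do. -/
theorem iteratedFDeriv_eq_zero_of_taylorCoeff {G : Param d → ℝ} (hG : ContDiff ℝ ∞ G) {N : ℕ}
    (h : ∀ m : Fin d → ℕ, ∑ i, m i = N → taylorCoeff G m = 0) : iteratedFDeriv ℝ N G 0 = 0 := by
  refine ContinuousMultilinearMap.toMultilinearMap_injective ?_
  refine Module.Basis.ext_multilinear (fun _ => Pi.basisFun ℝ (Fin d)) fun v => ?_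
  obtain ⟨m, σ, hσ⟩ := exists_fiber_counts v
  have hN : N = ∑ i, m i := by
    simpa using (Fintype.card_congr σ).symm
  subst hN
  have h1 := h m rfl
  rw [taylorCoeff, mul_eq_zero] at h1
  have h2 := h1.resolve_left (by
    rw [inv_eq_zero, Nat.cast_eq_zero, Finset.prod_eq_zero_iff]
    rintro ⟨i, -, hi⟩
    exact Nat.factorial_ne_zero _ hi)
  have h3 := iteratedFDeriv_comp_perm hG (fun s => (Pi.single (v s) 1 : Param d))
    (finSigmaFinEquiv.symm.trans σ) 0
  have h4 : (fun s => (Pi.single (v s) 1 : Param d)) ∘ (finSigmaFinEquiv.symm.trans σ) =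
      fun s => (Pi.single (finSigmaFinEquiv.symm s).1 1 : Param d) := by
    funext s
    simp [hσ]
  rw [h4, h2] at h3
  simpa using h3.symm

/-- The leading homogeneous part is given by the lowest derivative. -/
theorem homPart_eq_iteratedFDeriv {S : Param d → Plane → ℝ} {k : ℕ} (hS : SmoothPer S)
    {r : (Fin d → ℕ) → Plane → ℝ} (hr : Ord (k + 1) fun μ z => S μ z - homPart r k μ z)
    (μ : Param d) (z : Plane) :
    iteratedFDeriv ℝ k (fun ν => S ν z) 0 (fun _ => μ) = k.factorial * homPart r k μ z := by
  obtain ⟨s, hs, hS'⟩ := hr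
  have hSz : ContDiff ℝ ∞ fun ν => S ν z :=
    hS.smooth.comp (by fun_prop : ContDiff ℝ ∞ fun ν : Param d => (ν, z))
  -- Along the ray `t ↦ t • μ` the family is `t ^ k * e t` with `e` smooth and `e 0 = homPart r k μ
  -- z`. In Leibniz' rule at `0` only the term survives in which all `k` derivatives fall on `t ^
  -- k`.
  set e : ℝ → ℝ := fun t => homPart r k μ z + t *
    ∑ m ∈ Finset.Nat.antidiagonalTuple d (k + 1), monomial m μ * s m (t • μ) z with he
  have hec : ContDiff ℝ ∞ e := by
    refine contDiff_const.add (contDiff_id.mul (ContDiff.sum fun m _ => contDiff_const.mul ?_))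
    exact (hs m).smooth.comp (by fun_prop : ContDiff ℝ ∞ fun t : ℝ => (t • μ, z))
  have hmon : ∀ (m : Fin d → ℕ) (t : ℝ), monomial m (t • μ) = t ^ (∑ i, m i) * monomial m μ := by
    intro m t
    simp [monomial, mul_pow, Finset.prod_mul_distrib, Finset.prod_pow_eq_pow_sum]
  have hφ : (fun t : ℝ => S (t • μ) z) = fun t => t ^ k * e t := by
    funext t
    have h1 : S (t • μ) z - homPart r k (t • μ) z = _ := hS' (t • μ) z
    have h2 : homPart r k (t • μ) z = t ^ k * homPart r k μ z := by
      rw [homPart, homPart, Finset.mul_sum]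
      refine Finset.sum_congr rfl fun m hm => ?_
      have := hmon m t
      rw [Finset.Nat.mem_antidiagonalTuple.1 hm, monomial, monomial] at this
      rw [this, mul_assoc]
    have h3 : ∑ m ∈ Finset.Nat.antidiagonalTuple d (k + 1), monomial m (t • μ) * s m (t • μ) z =
        t ^ (k + 1) * ∑ m ∈ Finset.Nat.antidiagonalTuple d (k + 1),
          monomial m μ * s m (t • μ) z := by
      rw [Finset.mul_sum]
      refine Finset.sum_congr rfl fun m hm => ?_
      rw [hmon, Finset.Nat.mem_antidiagonalTuple.1 hm, mul_assoc]
    rw [h3, h2] at h1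
    simp only [he]
    linear_combination h1
  have hL := (ContinuousLinearMap.toSpanSingleton ℝ μ).iteratedFDeriv_comp_right
    (n := ∞) (i := k) hSz 0 (by norm_cast; exact le_top)
  have h1 : iteratedDeriv k (fun t : ℝ => S (t • μ) z) 0 =
      iteratedFDeriv ℝ k (fun ν => S ν z) 0 (fun _ => μ) := by
    rw [iteratedDeriv_eq_iteratedFDeriv]
    have : (fun t : ℝ => S (t • μ) z) =
        (fun ν => S ν z) ∘ ContinuousLinearMap.toSpanSingleton ℝ μ := rfl
    rw [this, hL]
    simp [ContinuousMultilinearMap.compContinuousLinearMap_apply]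
  rw [← h1, hφ, iteratedDeriv_fun_mul (by fun_prop) (hec.of_le (by norm_cast; exact le_top)).contDiffAt,
    Finset.sum_eq_single_of_mem k (by simp)]
  · simp [he, Nat.descFactorial_self]
  · intro i _ hi
    rw [iteratedDeriv_fun_pow_zero, if_neg hi]
    simp

theorem Ord.succ_of_taylorCoeff {S : Param d → Plane → ℝ} {k : ℕ} (hS : Ord k S)
    (h : ∀ z (m : Fin d → ℕ), ∑ i, m i = k → taylorCoeff (fun ν => S ν z) m = 0) :
    Ord (k + 1) S := by
  obtain ⟨r, -, hrS⟩ := hS.exists_sub_homPart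
  refine hrS.congr fun μ z => ?_
  have h1 := homPart_eq_iteratedFDeriv hS.smoothPer hrS μ z
  have hSz : ContDiff ℝ ∞ fun ν => S ν z :=
    hS.smoothPer.smooth.comp (by fun_prop : ContDiff ℝ ∞ fun ν : Param d => (ν, z))
  rw [iteratedFDeriv_eq_zero_of_taylorCoeff hSz (h z)] at h1
  have h2 : homPart r k μ z = 0 := by
    have := h1.symm
    rw [zero_apply, mul_eq_zero] at this
    exact this.resolve_left (by exact_mod_cast Nat.factorial_ne_zero k)
  rw [h2, sub_zero]

/-- A family that is flat at `μ = 0` lies in every power of the ideal, although it need not vanish.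
-/
theorem SmoothPer.ord_of_taylorCoeff {S : Param d → Plane → ℝ} (hS : SmoothPer S)
    (h : ∀ z (m : Fin d → ℕ), taylorCoeff (fun ν => S ν z) m = 0) (k : ℕ) : Ord k S := by
  induction k with
  | zero => exact Ord.of_smoothPer hS
  | succ k ih => exact ih.succ_of_taylorCoeff fun z m _ => h z m

theorem taylorCoeff_sub {G H : Param d → ℝ} (hG : ContDiff ℝ ∞ G) (hH : ContDiff ℝ ∞ H)
    (m : Fin d → ℕ) :
    taylorCoeff (fun ν => G ν - H ν) m = taylorCoeff G m - taylorCoeff H m := by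
  have hle : ((∑ i, m i : ℕ) : WithTop ℕ∞) ≤ ∞ := by norm_cast; exact le_top
  change taylorCoeff (G - H) m = _
  rw [taylorCoeff, iteratedFDeriv_sub_apply (hG.of_le hle).contDiffAt (hH.of_le hle).contDiffAt,
    taylorCoeff, taylorCoeff, ← mul_sub]
  rfl

theorem taylorCoeff_congr {G H : Param d → ℝ} (h : G =ᶠ[nhds 0] H) (m : Fin d → ℕ) :
    taylorCoeff G m = taylorCoeff H m := by
  rw [taylorCoeff, taylorCoeff, (h.iteratedFDeriv ℝ _).eq_of_nhds]

/-- The Taylor coefficients of degree one are those of the linear part. -/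
theorem taylorCoeff_eq_of_ord_two {F : Param d → Plane → ℝ} (hF : SmoothPer F)
    {r : (Fin d → ℕ) → Plane → ℝ} (hr : Ord 2 fun μ z => F μ z - homPart r 1 μ z)
    {m : Fin d → ℕ} (hm : ∑ i, m i = 1) (z : Plane) :
    taylorCoeff (fun ν => F ν z) m = r m z := by
  obtain ⟨i, -, hi⟩ : ∃ i ∈ Finset.univ, m i ≠ 0 := by
    refine Finset.exists_ne_zero_of_sum_ne_zero (f := m) ?_
    omega
  have hle : ∀ (m' : Fin d → ℕ) j, ∑ i, m' i = 1 → m' j ≠ 0 → m' = Pi.single j 1 := by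
    intro m' j h1 hj
    have h2 := Finset.add_sum_erase Finset.univ m' (Finset.mem_univ j)
    rw [h1] at h2
    have h3 : ∑ x ∈ Finset.univ.erase j, m' x = 0 := by omega
    funext l
    by_cases hl : l = j
    · subst hl; simp; omega
    · rw [Finset.sum_eq_zero_iff] at h3
      rw [h3 l (by simp [hl]), Pi.single_eq_of_ne hl]
  have hm' := hle m i hm hi
  have h1 := homPart_eq_iteratedFDeriv (k := 1) hF hr (Pi.single i 1) z
  have h2 : homPart r 1 (Pi.single i 1) z = r m z := by
    rw [homPart, Finset.sum_eq_single_of_mem m (Finset.Nat.mem_antidiagonalTuple.2 hm)]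
    · rw [Finset.prod_eq_one, one_mul]
      intro j _
      by_cases hj : j = i
      · subst hj; simp
      · rw [hm', Pi.single_eq_of_ne (M := fun _ => ℕ) hj, pow_zero]
    · intro b hb hne
      rw [Finset.Nat.mem_antidiagonalTuple] at hb
      obtain ⟨j, -, hj⟩ : ∃ i ∈ Finset.univ, b i ≠ 0 := by
        refine Finset.exists_ne_zero_of_sum_ne_zero (f := b) ?_
        omega
      have hji : j ≠ i := by
        rintro rfl
        exact hne ((hle b j hb hj).trans hm'.symm)
      rw [Finset.prod_eq_zero (Finset.mem_univ j), zero_mul]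
      rw [Pi.single_eq_of_ne hji, zero_pow hj]
  -- The number of slots in `taylorCoeff` is `∑ i, m i`, which equals `1` only propositionally.
  have h3 : ∀ N, N = 1 → iteratedFDeriv ℝ N (fun ν => F ν z) 0 (fun _ => Pi.single i 1) =
      iteratedFDeriv ℝ 1 (fun ν => F ν z) 0 (fun _ => Pi.single i 1) := by
    rintro N rfl; rfl
  have h4 : (fun s => (Pi.single (finSigmaFinEquiv.symm s : Σ i, Fin (m i)).1 1 : Param d)) =
      fun _ => Pi.single i 1 := by
    funext s
    congr 1
    by_contra hne
    have h5 := (finSigmaFinEquiv.symm s : Σ i, Fin (m i)).2.pos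
    rw [congrFun hm' _, Pi.single_eq_of_ne hne] at h5
    exact lt_irrefl _ h5
  have h5 : ∏ i, (m i).factorial = 1 := Finset.prod_eq_one fun j _ => by
    rw [hm']
    by_cases hj : j = i
    · subst hj; simp
    · rw [Pi.single_eq_of_ne hj]; simp
  rw [taylorCoeff, h4, h3 _ hm, h1, h2, h5]
  simp

theorem isBiperiodic_taylorCoeff {F : Param d → Plane → ℝ} (hF : SmoothPer F) (m : Fin d → ℕ) :
    IsBiperiodic fun z => taylorCoeff (fun ν => F ν z) m :=
  isBiperiodic_of_add_int fun z a b => by simp only [(hF.per _).add_int]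

/-- The derivative in `μ` is the joint derivative restricted to the parameter directions. Continuity
in the phase is what the uniqueness of Fourier coefficients requires. -/
theorem continuous_taylorCoeff {F : Param d → Plane → ℝ} (hF : SmoothPer F) (m : Fin d → ℕ) :
    Continuous fun z => taylorCoeff (fun ν => F ν z) m := by
  have hle : ((∑ i, m i : ℕ) : WithTop ℕ∞) ≤ ∞ := by norm_cast; exact le_top
  set f : Param d × Plane → ℝ := fun w => F w.1 w.2
  have h : ∀ z, iteratedFDeriv ℝ (∑ i, m i) (fun ν => F ν z) 0 =
      (iteratedFDeriv ℝ (∑ i, m i) f (0, z)).compContinuousLinearMap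
        fun _ => ContinuousLinearMap.inl ℝ (Param d) Plane := by
    intro z
    have h1 : (fun ν => F ν z) = (fun w => f (w + (0, z))) ∘
        ContinuousLinearMap.inl ℝ (Param d) Plane := by
      funext ν; simp [f]
    have h2 : ContDiff ℝ ∞ fun w => f (w + (0, z)) := hF.smooth.comp (by fun_prop)
    rw [h1, ContinuousLinearMap.iteratedFDeriv_comp_right _ h2 _ hle, iteratedFDeriv_comp_add_right]
    simp
  simp only [taylorCoeff, h, ContinuousMultilinearMap.compContinuousLinearMap_apply]
  refine continuous_const.mul ?_
  have h3 : Continuous fun z : Plane => iteratedFDeriv ℝ (∑ i, m i) f (0, z) :=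
    (hF.smooth.continuous_iteratedFDeriv hle).comp (by fun_prop)
  exact (ContinuousMultilinearMap.apply ℝ (fun _ : Fin (∑ i, m i) => Param d × Plane) ℝ
    _).continuous.comp h3

end Taylor

/-! ### Fourier series and resonance. -/

section Fourier

/-- The one-dimensional Fourier mode `exp (2πi k x)`. -/
noncomputable def wave (k : ℤ) (x : ℝ) : ℂ := Complex.exp (2 * Real.pi * Complex.I * (k * x))

theorem mode_eq (k l : ℤ) (z : Plane) : mode k l z = wave k z.1 * wave l z.2 := by
  rw [mode, wave, wave, ← Complex.exp_add]
  ring_nf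

theorem wave_add (k : ℤ) (x y : ℝ) : wave k (x + y) = wave k x * wave k y := by
  rw [wave, wave, wave, ← Complex.exp_add]
  push_cast
  ring_nf

theorem wave_eq_one_iff (k : ℤ) (x : ℝ) : wave k x = 1 ↔ ∃ n : ℤ, (k : ℝ) * x = n := by
  rw [wave, Complex.exp_eq_one_iff]
  refine exists_congr fun n => ?_
  rw [mul_comm (n : ℂ), mul_right_inj' Complex.two_pi_I_ne_zero]
  norm_cast

theorem periodic_wave (k : ℤ) : Function.Periodic (wave k) 1 := fun x => by
  rw [wave_add, (wave_eq_one_iff k 1).2 ⟨k, mul_one _⟩, mul_one]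

theorem norm_wave (k : ℤ) (x : ℝ) : ‖wave k x‖ = 1 := by
  have : wave k x = Complex.exp ((2 * Real.pi * (k * x) : ℝ) * Complex.I) := by
    rw [wave]; push_cast; ring_nf
  rw [this, Complex.norm_exp_ofReal_mul_I]

theorem hasDerivAt_wave (k : ℤ) (x : ℝ) :
    HasDerivAt (wave k) (2 * Real.pi * Complex.I * k * wave k x) x := by
  have h1 : HasDerivAt (fun x : ℝ => 2 * Real.pi * Complex.I * ((k : ℂ) * (x : ℂ)))
      (2 * Real.pi * Complex.I * ((k : ℂ) * 1)) x :=
    ((Complex.ofRealCLM.hasDerivAt (x := x)).const_mul (k : ℂ)).const_mul _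
  refine h1.cexp.congr_deriv ?_
  rw [wave]; ring

theorem continuous_wave (k : ℤ) : Continuous (wave k) := by
  unfold wave; fun_prop

/-- The Fourier coefficients of a 1-periodic function. -/
noncomputable def waveCoeff (A : ℝ → ℂ) (k : ℤ) : ℂ := ∫ x in (0 : ℝ)..1, A x * wave (-k) x

theorem hasSum_wave {A : ℝ → ℂ} (hA : Continuous A) (hp : Function.Periodic A 1)
    (hs : Summable (waveCoeff A)) (x : ℝ) :
    HasSum (fun k => waveCoeff A k * wave k x) (A x) := by
  have : Fact ((0 : ℝ) < 1) := ⟨one_pos⟩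
  let f : C(AddCircle (1 : ℝ), ℂ) := ⟨hp.lift, continuous_coinduced_dom.2 hA⟩
  have hf : ∀ x : ℝ, f (x : AddCircle (1 : ℝ)) = A x := fun x => hp.lift_coe x
  have hw : ∀ (k : ℤ) (x : ℝ), fourier k (x : AddCircle (1 : ℝ)) = wave k x := fun k x => by
    rw [fourier_coe_apply, wave]
    push_cast
    ring_nf
  have hc : fourierCoeff f = waveCoeff A := by
    funext k
    rw [fourierCoeff_eq_intervalIntegral _ _ 0, waveCoeff]
    simp only [hf, hw, smul_eq_mul, zero_add, div_one, one_smul]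
    exact intervalIntegral.integral_congr fun x _ => mul_comm _ _
  have := has_pointwise_sum_fourier_series_of_summable (f := f) (hc ▸ hs) (x : AddCircle (1 : ℝ))
  simpa only [hc, hf, hw, smul_eq_mul] using this

/-- Vanishing coefficients are summable, so the Fourier series converges pointwise to `A`. -/
theorem eq_zero_of_waveCoeff {A : ℝ → ℂ} (hA : Continuous A) (hp : Function.Periodic A 1)
    (h : ∀ k, waveCoeff A k = 0) (x : ℝ) : A x = 0 := by
  have h0 : waveCoeff A = fun _ => 0 := funext h
  have h1 := hasSum_wave hA hp (by rw [h0]; exact summable_zero) x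
  simp only [h, zero_mul] at h1
  exact h1.unique hasSum_zero

theorem periodic_deriv {A : ℝ → ℂ} (hp : Function.Periodic A 1) :
    Function.Periodic (deriv A) 1 := fun x => by
  have h : (fun y => A (y + 1)) = A := funext hp
  rw [← deriv_comp_add_const, h]

theorem waveCoeff_deriv {A : ℝ → ℂ} (hA : ContDiff ℝ 1 A) (hp : Function.Periodic A 1) (k : ℤ) :
    waveCoeff (deriv A) k = 2 * Real.pi * Complex.I * k * waveCoeff A k := by
  have hd : ∀ x ∈ Set.uIcc (0 : ℝ) 1, HasDerivAt (fun x => A x * wave (-k) x)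
      (deriv A x * wave (-k) x + A x * (2 * Real.pi * Complex.I * ((-k : ℤ) : ℂ) * wave (-k) x))
      x := fun x _ => ((hA.differentiable one_ne_zero x).hasDerivAt).mul (hasDerivAt_wave (-k) x)
  have h1 : Continuous fun x => deriv A x * wave (-k) x :=
    (hA.continuous_deriv le_rfl).mul (continuous_wave _)
  have h2 : Continuous fun x =>
      A x * (2 * Real.pi * Complex.I * ((-k : ℤ) : ℂ) * wave (-k) x) :=
    hA.continuous.mul (continuous_const.mul (continuous_wave _))
  have h3 := intervalIntegral.integral_eq_sub_of_hasDerivAt hd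
    ((h1.add h2).intervalIntegrable _ _)
  rw [intervalIntegral.integral_add (h1.intervalIntegrable _ _) (h2.intervalIntegrable _ _)] at h3
  have h4 : A 1 = A 0 := by simpa using hp 0
  have h5 : wave (-k) 1 = wave (-k) 0 := by simpa using periodic_wave (-k) 0
  have h6 : ∀ x, A x * (2 * Real.pi * Complex.I * ((-k : ℤ) : ℂ) * wave (-k) x) =
      -(2 * Real.pi * Complex.I * k) * (A x * wave (-k) x) := fun x => by push_cast; ring
  simp only [h6] at h3
  rw [h4, h5, sub_self, intervalIntegral.integral_const_mul] at h3
  rw [waveCoeff, waveCoeff]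
  linear_combination h3

/-- Two integrations by parts bound the coefficients by a multiple of `1 / k ^ 2`. -/
theorem summable_waveCoeff {A : ℝ → ℂ} (hA : ContDiff ℝ ∞ A) (hp : Function.Periodic A 1) :
    Summable (waveCoeff A) := by
  have hA' : ContDiff ℝ ∞ (deriv A) := ((contDiff_infty_iff_deriv).1 hA).2
  have hA'' : ContDiff ℝ ∞ (deriv (deriv A)) := ((contDiff_infty_iff_deriv).1 hA').2
  have hle : (1 : WithTop ℕ∞) ≤ ∞ := by norm_cast
  have hp' := periodic_deriv hp
  have h2 : ∀ k, waveCoeff (deriv (deriv A)) k =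
      (2 * Real.pi * Complex.I * k) ^ 2 * waveCoeff A k := fun k => by
    rw [waveCoeff_deriv (hA'.of_le hle) hp', waveCoeff_deriv (hA.of_le hle) hp]
    ring
  obtain ⟨M, hM⟩ := isCompact_uIcc.exists_bound_of_continuousOn (s := Set.uIcc (0 : ℝ) 1)
    hA''.continuous.continuousOn
  have h3 : ∀ k, ‖waveCoeff (deriv (deriv A)) k‖ ≤ M := fun k => by
    have := intervalIntegral.norm_integral_le_of_norm_le_const (a := 0) (b := 1) (C := M)
      (f := fun x => deriv (deriv A) x * wave (-k) x) (fun x hx => by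
        rw [norm_mul, norm_wave, mul_one]
        exact hM x (Set.uIoc_subset_uIcc hx))
    simpa [waveCoeff] using this
  refine Summable.of_norm_bounded_eventually (g := fun k : ℤ => M / (2 * Real.pi) ^ 2 *
    (1 / (k : ℝ) ^ 2)) ((Real.summable_one_div_int_pow.2 one_lt_two).mul_left _) ?_
  have hfin : ({0} : Set ℤ).Finite := Set.finite_singleton 0
  filter_upwards [hfin.compl_mem_cofinite] with k hk
  have hk0 : (k : ℝ) ≠ 0 := by
    have : k ≠ 0 := by simpa using hk
    exact_mod_cast this
  have h4 := h3 k
  have hn : ‖(2 * Real.pi * Complex.I * k : ℂ)‖ ^ 2 = (2 * Real.pi) ^ 2 * (k : ℝ) ^ 2 := by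
    simp [mul_pow, abs_of_pos Real.pi_pos]
  rw [h2, norm_mul, norm_pow, hn] at h4
  have hpos : 0 < (2 * Real.pi) ^ 2 * (k : ℝ) ^ 2 := by positivity
  rw [div_mul_div_comm, mul_one, le_div_iff₀ hpos]
  linarith

theorem waveCoeff_shift {A : ℝ → ℂ} (hp : Function.Periodic A 1) (k : ℤ) (t : ℝ) :
    waveCoeff (fun x => A (x + t)) k = wave k t * waveCoeff A k := by
  have hper : Function.Periodic (fun x => A x * wave (-k) x) 1 := fun x => by
    simp only [hp x, periodic_wave (-k) x]
  have h1 := hper.intervalIntegral_add_eq t 0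
  have h2 := intervalIntegral.integral_comp_add_right (a := 0) (b := 1)
    (fun x => A x * wave (-k) x) t
  have h3 : ∀ x, A (x + t) * wave (-k) x =
      wave k t * (A (x + t) * wave (-k) (x + t)) := fun x => by
    have : wave (-k) t * wave k t = 1 := by
      rw [wave, wave, ← Complex.exp_add]
      push_cast
      ring_nf
      exact Complex.exp_zero
    rw [wave_add]
    linear_combination (-A (x + t) * wave (-k) x) * this
  rw [waveCoeff, waveCoeff]
  simp only [h3]
  rw [intervalIntegral.integral_const_mul, h2]
  simp only [zero_add, add_comm (1 : ℝ) t] at h1 ⊢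
  rw [h1]

/-- The Fourier series of a function which is constant along `p ∂_x + q ∂_y` has only resonant
terms. -/
theorem hasSum_resonant {p q : ℤ} (hq : q ≠ 0) {a : Plane → ℝ} (ha : ContDiff ℝ ∞ a)
    (hp : IsBiperiodic a) (hinv : ∀ z (t : ℝ), a (z + t • ((p : ℝ), (q : ℝ))) = a z) (z : Plane) :
    HasSum (fun r : {kl : ℤ × ℤ // p * kl.1 + q * kl.2 = 0} =>
      waveCoeff (fun x => (a (x, 0) : ℂ)) r.1.1 * mode r.1.1 r.1.2 z) (a z : ℂ) := by
  have hq' : (q : ℝ) ≠ 0 := by exact_mod_cast hq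
  set A : ℝ → ℂ := fun x => (a (x, 0) : ℂ) with hA
  have hAs : ContDiff ℝ ∞ A :=
    Complex.ofRealCLM.contDiff.comp (ha.comp (by fun_prop : ContDiff ℝ ∞ fun x : ℝ => (x, (0 : ℝ))))
  have hAp : Function.Periodic A 1 := fun x => by simp only [hA, (hp x 0).1]
  -- The orbit through `z` meets the line `y = 0` at `x = w`, so `a` is determined by its
  -- restriction `A`.
  set w : ℝ := z.1 - (p : ℝ) / q * z.2 with hw
  have haz : A w = (a z : ℂ) := by
    have h1 := hinv z (-z.2 / q)
    have h2 : z + (-z.2 / q) • ((p : ℝ), (q : ℝ)) = (w, 0) := by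
      refine Prod.ext ?_ ?_
      · simp only [Prod.fst_add, Prod.smul_mk, smul_eq_mul, hw]; ring
      · simp only [Prod.snd_add, Prod.smul_mk, smul_eq_mul]; field_simp; ring
    rw [h2] at h1
    simp only [hA, h1]
  -- An orbit starting on `y = 0` reaches `y = 1` shifted by `p / q`; hence `A` has the additional
  -- period `p / q`.
  have hAshift : (fun x => A (x + (p : ℝ) / q)) = A := by
    funext x
    have h1 := hinv (x, 0) (1 / q)
    have h2 : ((x, 0) : Plane) + (1 / (q : ℝ)) • ((p : ℝ), (q : ℝ)) = (x + (p : ℝ) / q, 0 + 1) := by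
      refine Prod.ext ?_ ?_
      · simp only [Prod.fst_add, Prod.smul_mk, smul_eq_mul]; ring
      · simp only [Prod.snd_add, Prod.smul_mk, smul_eq_mul]; field_simp
    rw [h2, (hp _ _).2] at h1
    simp only [hA, h1]
  have hsum := hasSum_wave hAs.continuous hAp (summable_waveCoeff hAs hAp) w
  rw [haz] at hsum
  -- Since `q ≠ 0`, a resonant pair is determined by `k`, and the resonant series is a subseries of
  -- the one-dimensional series of `A`.
  have hinj : Function.Injective
      fun r : {kl : ℤ × ℤ // p * kl.1 + q * kl.2 = 0} => r.1.1 := by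
    rintro ⟨⟨k, l⟩, h1⟩ ⟨⟨k', l'⟩, h2⟩ (rfl : k = k')
    have : q * l = q * l' := by simp only at h1 h2; linarith
    obtain rfl := mul_left_cancel₀ hq this
    rfl
  -- The additional period forces a coefficient to vanish unless `k * p / q` is an integer, that is,
  -- unless `k` belongs to a resonant pair.
  have hzero : ∀ k ∉ Set.range fun r : {kl : ℤ × ℤ // p * kl.1 + q * kl.2 = 0} => r.1.1,
      waveCoeff A k * wave k w = 0 := by
    intro k hk
    have h1 := waveCoeff_shift hAp k ((p : ℝ) / q)
    rw [hAshift] at h1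
    by_contra hne
    have hc : waveCoeff A k ≠ 0 := left_ne_zero_of_mul hne
    have h2 : wave k ((p : ℝ) / q) = 1 := by
      have : (wave k ((p : ℝ) / q) - 1) * waveCoeff A k = 0 := by linear_combination -h1
      exact sub_eq_zero.1 ((mul_eq_zero.1 this).resolve_right hc)
    obtain ⟨n, hn⟩ := (wave_eq_one_iff _ _).1 h2
    refine hk ⟨⟨(k, -n), ?_⟩, rfl⟩
    have h3 : (p : ℝ) * k = n * q := by rw [← hn]; field_simp
    have h4 : p * k = n * q := by exact_mod_cast h3
    simp only
    linarith
  refine ((hinj.hasSum_iff hzero).2 hsum).congr_fun ?_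
  rintro ⟨⟨k, l⟩, hkl⟩
  simp only [Function.comp]
  congr 1
  rw [mode_eq, wave, wave, wave, ← Complex.exp_add]
  have hl : (l : ℂ) = -((p : ℂ) * k / q) := by
    have hqc : (q : ℂ) ≠ 0 := by exact_mod_cast hq
    have h5 : (p : ℂ) * k + q * l = 0 := by exact_mod_cast hkl
    field_simp
    linear_combination h5
  rw [hl, hw]
  push_cast
  ring_nf

theorem swap_intervalIntegral {f : ℝ → ℝ → ℂ} (hf : Continuous fun w : ℝ × ℝ => f w.1 w.2) :
    ∫ x in (0 : ℝ)..1, ∫ y in (0 : ℝ)..1, f x y = ∫ y in (0 : ℝ)..1, ∫ x in (0 : ℝ)..1, f x y := by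
  refine MeasureTheory.intervalIntegral_intervalIntegral_swap ?_
  exact (hf.continuousOn.integrableOn_compact (isCompact_uIcc.prod isCompact_uIcc)).mono_set
    (Set.prod_mono Set.uIoc_subset_uIcc Set.uIoc_subset_uIcc)

theorem integral_comp_int_mul {H : ℝ → ℂ} (hH : Continuous H) (hp : Function.Periodic H 1) {q : ℤ}
    (hq : q ≠ 0) : ∫ s in (0 : ℝ)..1, H (q * s) = ∫ y in (0 : ℝ)..1, H y := by
  have hq' : (q : ℝ) ≠ 0 := by exact_mod_cast hq
  have h1 := hp.intervalIntegral_add_zsmul_eq q 0 fun _ _ => hH.intervalIntegrable _ _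
  rw [intervalIntegral.integral_comp_mul_left (fun y => H y) hq']
  simp only [zero_add, zsmul_eq_mul, mul_one, mul_zero] at h1 ⊢
  rw [h1, Complex.real_smul]
  push_cast
  have hqc : (q : ℂ) ≠ 0 := by exact_mod_cast hq
  field_simp

/-- Averaging over the orbits of `p ∂_x + q ∂_y` keeps the resonant Fourier coefficients. -/
theorem waveCoeff_orbitMean {p q : ℤ} (hq : q ≠ 0) {r : Plane → ℝ} (hr : Continuous r)
    (hp : IsBiperiodic r) {k l : ℤ} (hkl : p * k + q * l = 0) :
    waveCoeff (fun x => (orbitMean p q r (x, 0) : ℂ)) k =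
      ∫ x in (0 : ℝ)..1, ∫ y in (0 : ℝ)..1, (r (x, y) : ℂ) * mode (-k) (-l) (x, y) := by
  have hwc := continuous_wave
  have e1 : ∀ x : ℝ, (orbitMean p q r (x, 0) : ℂ) * wave (-k) x =
      ∫ s in (0 : ℝ)..1, (r (x + s * p, s * q) : ℂ) * wave (-k) x := by
    intro x
    rw [intervalIntegral.integral_mul_const, orbitMean, ← intervalIntegral.integral_ofReal]
    simp
  -- Shifting `x` by `s * p` produces the phase `wave k (s * p)`, which resonance turns into `wave
  -- (-l) (q * s)`. The `s`-integral then runs over `q` periods in `y`.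
  have e2 : ∀ s : ℝ, ∫ x in (0 : ℝ)..1, (r (x + s * p, s * q) : ℂ) * wave (-k) x =
      ∫ x in (0 : ℝ)..1, (r (x, q * s) : ℂ) * mode (-k) (-l) (x, q * s) := by
    intro s
    have h1 := waveCoeff_shift (A := fun x => (r (x, s * q) : ℂ))
      (fun x => by simp only [(hp x (s * q)).1]) k (s * p)
    rw [waveCoeff, waveCoeff] at h1
    rw [h1, ← intervalIntegral.integral_const_mul]
    refine intervalIntegral.integral_congr fun x _ => ?_
    have h2 : wave k (s * p) = wave (-l) (q * s) := by
      have h5 : (p : ℂ) * k + q * l = 0 := by exact_mod_cast hkl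
      rw [wave, wave]
      congr 1
      push_cast
      linear_combination (2 * Real.pi * Complex.I * s) * h5
    simp only [mode_eq]
    rw [h2, mul_comm (q : ℝ) s]
    ring
  rw [waveCoeff]
  simp only [e1]
  rw [swap_intervalIntegral (f := fun x s => (r (x + s * p, s * q) : ℂ) * wave (-k) x) (by fun_prop)]
  simp only [e2]
  have hmode : Continuous fun w : ℝ × ℝ => (r (w.1, w.2) : ℂ) * mode (-k) (-l) (w.1, w.2) := by
    simp only [mode_eq]; fun_prop
  rw [integral_comp_int_mul (H := fun y => ∫ x in (0 : ℝ)..1,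
    (r (x, y) : ℂ) * mode (-k) (-l) (x, y)) ?_ ?_ hq]
  · exact (swap_intervalIntegral (f := fun x y => (r (x, y) : ℂ) * mode (-k) (-l) (x, y))
      hmode).symm
  · exact intervalIntegral.continuous_parametric_intervalIntegral_of_continuous'
      (f := fun y x => (r (x, y) : ℂ) * mode (-k) (-l) (x, y)) (hmode.comp continuous_swap) 0 1
  · intro y
    simp only [mode_eq, (hp _ y).2, periodic_wave (-l) y]

/-- A continuous biperiodic function is determined by its Fourier coefficients. -/
theorem eq_of_fourier_eq {h₁ h₂ : Plane → ℝ} (c₁ : Continuous h₁) (c₂ : Continuous h₂)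
    (p₁ : IsBiperiodic h₁) (p₂ : IsBiperiodic h₂)
    (h : ∀ k l : ℤ, ∫ x in (0 : ℝ)..1, ∫ y in (0 : ℝ)..1, (h₁ (x, y) : ℂ) * mode (-k) (-l) (x, y) =
      ∫ x in (0 : ℝ)..1, ∫ y in (0 : ℝ)..1, (h₂ (x, y) : ℂ) * mode (-k) (-l) (x, y)) :
    h₁ = h₂ := by
  have hwc := continuous_wave
  set f : ℝ → ℝ → ℂ := fun x y => (h₁ (x, y) : ℂ) - h₂ (x, y) with hf
  have hfc : Continuous fun w : ℝ × ℝ => f w.1 w.2 := by simp only [hf]; fun_prop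
  have hI : ∀ (l : ℤ) {g : Plane → ℝ}, Continuous g →
      Continuous fun x : ℝ => ∫ y in (0 : ℝ)..1, (g (x, y) : ℂ) * wave (-l) y := fun l g hg =>
    intervalIntegral.continuous_parametric_intervalIntegral_of_continuous'
      (f := fun x y => (g (x, y) : ℂ) * wave (-l) y) (by fun_prop) 0 1
  have hsub : ∀ l x, waveCoeff (f x) l = (∫ y in (0 : ℝ)..1, (h₁ (x, y) : ℂ) * wave (-l) y) -
      ∫ y in (0 : ℝ)..1, (h₂ (x, y) : ℂ) * wave (-l) y := by
    intro l x
    rw [waveCoeff, ← intervalIntegral.integral_sub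
      (Continuous.intervalIntegrable (by fun_prop) _ _)
      (Continuous.intervalIntegrable (by fun_prop) _ _)]
    exact intervalIntegral.integral_congr fun y _ => by simp only [hf]; ring
  have hin : ∀ (k l : ℤ) (g : Plane → ℝ),
      ∫ x in (0 : ℝ)..1, ∫ y in (0 : ℝ)..1, (g (x, y) : ℂ) * mode (-k) (-l) (x, y) =
      ∫ x in (0 : ℝ)..1, (∫ y in (0 : ℝ)..1, (g (x, y) : ℂ) * wave (-l) y) * wave (-k) x := by
    intro k l g
    refine intervalIntegral.integral_congr fun x _ => ?_
    simp only [← intervalIntegral.integral_mul_const, mode_eq]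
    exact intervalIntegral.integral_congr fun y _ => by ring
  -- One-dimensional uniqueness is applied twice: in `x` to each `y`-coefficient, then in `y`.
  have h0 : ∀ l x, waveCoeff (f x) l = 0 := by
    intro l
    refine eq_zero_of_waveCoeff (A := fun x => waveCoeff (f x) l) ?_ ?_ fun k => ?_
    · simp only [hsub]
      exact (hI l c₁).sub (hI l c₂)
    · intro x
      have : f (x + 1) = f x := by
        funext y; simp only [hf, (p₁ x y).1, (p₂ x y).1]
      simp only [this]
    · rw [waveCoeff]
      simp only [hsub, sub_mul]
      have i1 : IntervalIntegrable (fun x => (∫ y in (0 : ℝ)..1, (h₁ (x, y) : ℂ) * wave (-l) y) *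
          wave (-k) x) MeasureTheory.volume 0 1 :=
        ((hI l c₁).mul (continuous_wave (-k))).intervalIntegrable _ _
      have i2 : IntervalIntegrable (fun x => (∫ y in (0 : ℝ)..1, (h₂ (x, y) : ℂ) * wave (-l) y) *
          wave (-k) x) MeasureTheory.volume 0 1 :=
        ((hI l c₂).mul (continuous_wave (-k))).intervalIntegrable _ _
      rw [intervalIntegral.integral_sub i1 i2, ← hin, ← hin, h, sub_self]
  funext z
  have hz := eq_zero_of_waveCoeff (A := f z.1)
    (hfc.comp (by fun_prop : Continuous fun y : ℝ => (z.1, y)))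
    (fun y => by simp only [hf, (p₁ z.1 y).2, (p₂ z.1 y).2]) (fun l => h0 l z.1) z.2
  simp only [hf, sub_eq_zero] at hz
  exact_mod_cast hz

end Fourier

/-! ### Dependence on the coefficients alone, localisation, and the final assembly. -/

variable {d : ℕ}

/-- Functions with the same Fourier-Taylor coefficients agree to all orders in the parameters. -/
theorem ord_sub_of_fourierTaylorCoeff_eq {F G : Param d → Plane → ℝ} (hF : SmoothPer F)
    (hG : SmoothPer G) (h : fourierTaylorCoeff F = fourierTaylorCoeff G) (k : ℕ) :
    Ord k fun μ z => G μ z - F μ z := by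
  have hz : ∀ {S : Param d → Plane → ℝ}, SmoothPer S → ∀ z, ContDiff ℝ ∞ fun ν => S ν z :=
    fun hS z => hS.smooth.comp (by fun_prop : ContDiff ℝ ∞ fun ν : Param d => (ν, z))
  refine (hG.sub hF).ord_of_taylorCoeff (fun z m => ?_) k
  rw [taylorCoeff_sub (hz hG z) (hz hF z), sub_eq_zero]
  have := eq_of_fourier_eq (continuous_taylorCoeff hG m) (continuous_taylorCoeff hF m)
    (isBiperiodic_taylorCoeff hG m) (isBiperiodic_taylorCoeff hF m)
    fun k l => (congrFun (congrFun (congrFun h k) l) m).symm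
  exact congrFun this z

/-- A normal form whose resonant Fourier coefficients are determined by the Fourier-Taylor
coefficients `c` of the vector field. -/
theorem exists_normal_form_coeff (n : ℕ) (p q : ℤ) (hq : q ≠ 0) (c : CoeffArray d) :
    ∃ t : CoeffArray d,
      (∀ (k l : ℤ) (m : Fin d → ℕ), p * k + q * l = 0 → ∑ i, m i = 1 → t k l m = c k l m) ∧
      ∀ F : Param d → Plane → ℝ, Ord 1 F → fourierTaylorCoeff F = c →
        ∃ g a : (Fin d → ℕ) → Plane → ℝ, ∃ R : Param d → Plane → ℝ,
          (∀ m, ContDiff ℝ ∞ (g m) ∧ IsBiperiodic (g m)) ∧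
          (∀ m, ContDiff ℝ ∞ (a m) ∧ IsBiperiodic (a m)) ∧
          (∀ m : Fin d → ℕ, ∑ i, m i ∈ Finset.Icc 1 n → ∀ z : Plane,
            HasSum (fun r : {kl : ℤ × ℤ // p * kl.1 + q * kl.2 = 0} =>
              t r.1.1 r.1.2 m * mode r.1.1 r.1.2 z) ((a m z : ℝ) : ℂ)) ∧
          Ord (n + 1) R ∧
          ∀ μ, transformed (fun j μ => generatorFlow g j μ 1) (oscillatorField p q F) n μ =
            oscillatorField p q
              (fun μ z => (∑ j ∈ Finset.Icc 1 n, homPart a j μ z) + R μ z) μ := by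
  classical
  -- One representative of the array fixes the new coefficients; an array without representative
  -- imposes no condition.
  by_cases hc : ∃ G : Param d → Plane → ℝ, Ord 1 G ∧ fourierTaylorCoeff G = c
  · obtain ⟨G, hG, hGc⟩ := hc
    obtain ⟨g, a, R, hg, ha, hinv, hone, hR, htr⟩ := exists_normal_form p q hq hG n
    -- In degree one the coefficients are kept by definition; that they are the Fourier coefficients
    -- of the averaged term is verified below.
    refine ⟨fun k l m => if ∑ i, m i = 1 then c k l m else
      waveCoeff (fun x => (a m (x, 0) : ℂ)) k, fun k l m _ hm => if_pos hm, fun F hF hFc => ?_⟩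
    have hS : Ord (n + 1) fun μ z => F μ z - G μ z :=
      ord_sub_of_fourierTaylorCoeff_eq hG.smoothPer hF.smoothPer (hGc.trans hFc.symm) _
    obtain ⟨F', S', hS', h1, h2⟩ : ∃ F' S' : Param d → Plane → ℝ, Ord (n + 1) S' ∧ (∀ μ,
        transformed (fun j μ => generatorFlow g j μ 1) (oscillatorField p q G) n μ =
          oscillatorField p q F' μ) ∧ ∀ μ,
        transformed (fun j μ => generatorFlow g j μ 1)
          (oscillatorField p q fun μ z => G μ z + (F μ z - G μ z)) n μ =
          oscillatorField p q (fun μ z => F' μ z + S' μ z) μ := by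
      obtain ⟨F', S', hS', h⟩ := exists_transformed_add p q (F := G) hS hg n
      exact ⟨F', S', hS', fun μ => (h μ).1, fun μ => (h μ).2⟩
    refine ⟨g, a, fun μ z => R μ z + S' μ z, hg, ha, fun m hm z => ?_, hR.add hS', fun μ => ?_⟩
    · convert hasSum_resonant hq (ha m).1 (ha m).2 (hinv m) z using 3 with r
      beta_reduce
      split_ifs with hm1
      · obtain ⟨s, hs, hs2, has⟩ := hone (by simp only [Finset.mem_Icc] at hm; omega)
        rw [has m hm1, waveCoeff_orbitMean hq (hs m).1.continuous (hs m).2 r.2, ← hGc]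
        simp only [fourierTaylorCoeff, taylorCoeff_eq_of_ord_two hG.smoothPer hs2 hm1]
      · rfl
    · have hF' : ∀ z, F' μ z = (∑ j ∈ Finset.Icc 1 n, homPart a j μ z) + R μ z := by
        intro z
        have := congrArg Prod.fst (congrFun ((h1 μ).symm.trans (htr μ)) z)
        exact add_left_cancel this
      have e : (fun μ z => G μ z + (F μ z - G μ z)) = F := by
        funext μ z; ring
      rw [e] at h2
      rw [h2 μ]
      funext z
      simp only [oscillatorField, hF', add_assoc]
  · exact ⟨c, fun _ _ _ _ _ => rfl, fun F hF hFc => (hc ⟨F, hF, hFc⟩).elim⟩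

/-- A family given near `μ = 0` extends to all parameters after shrinking. -/
theorem exists_ord_one_extension {U : Set (Param d)} {F : Param d → Plane → ℝ} (hU : IsOpen U)
    (h0 : (0 : Param d) ∈ U)
    (hF : ContDiffOn ℝ ∞ (fun w : Param d × Plane => F w.1 w.2) (U ×ˢ Set.univ))
    (hper : ∀ μ ∈ U, IsBiperiodic (F μ)) (hz : ∀ z, F 0 z = 0) :
    ∃ G : Param d → Plane → ℝ, Ord 1 G ∧ ∀ᶠ μ in nhds (0 : Param d), G μ = F μ := by
  obtain ⟨ε, hε, hεU⟩ := Metric.isOpen_iff.1 hU 0 h0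
  -- The cutoff is `1` near `0` and vanishes outside a closed ball inside `U`, so the values of `F`
  -- off `U` do not matter.
  let χ : ContDiffBump (0 : Param d) := ⟨ε / 4, ε / 2, by positivity, by linarith⟩
  have hsupp : ∀ μ, μ ∉ Metric.closedBall (0 : Param d) (ε / 2) → χ μ = 0 := fun μ hμ =>
    χ.zero_of_le_dist (not_le.1 hμ).le
  have hsub : Metric.closedBall (0 : Param d) (ε / 2) ⊆ U :=
    (Metric.closedBall_subset_ball (by linarith)).trans hεU
  have hS : SmoothPer fun μ z => χ μ * F μ z := by
    refine ⟨contDiff_iff_contDiffAt.2 fun w => ?_, fun μ x y => ?_⟩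
    · by_cases hw : w.1 ∈ U
      · have h1 : ContDiffAt ℝ ∞ (fun w : Param d × Plane => F w.1 w.2) w :=
          hF.contDiffAt ((hU.prod isOpen_univ).mem_nhds ⟨hw, trivial⟩)
        exact (χ.contDiff.contDiffAt.comp w contDiffAt_fst).mul h1
      · have h1 : ∀ᶠ v : Param d × Plane in nhds w, v.1 ∉ Metric.closedBall (0 : Param d) (ε / 2) :=
          continuous_fst.continuousAt.eventually
            (Metric.isClosed_closedBall.isOpen_compl.mem_nhds fun h => hw (hsub h))
        refine contDiffAt_const (c := (0 : ℝ)) |>.congr_of_eventuallyEq ?_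
        filter_upwards [h1] with v hv
        rw [hsupp v.1 hv, zero_mul]
    · by_cases hμ : μ ∈ U
      · simp only [hper μ hμ x y, and_self]
      · simp only [hsupp μ fun h => hμ (hsub h), zero_mul, and_self]
  refine ⟨fun μ z => χ μ * F μ z, (Ord.sub_at_zero hS).congr fun μ z => ?_, ?_⟩
  · simp only [hz, mul_zero, sub_zero]
  · filter_upwards [χ.eventuallyEq_one] with μ hμ
    funext z
    rw [hμ, Pi.one_apply, one_mul]

end ForcedOscillator

open ForcedOscillator in
theorem proposition3 (d n : ℕ) (p q : ℤ) (hq : q ≠ 0) :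
    -- the new coefficients as a function `T` of the original ones
    ∃ T : CoeffArray d → CoeffArray d,
      -- the resonant coefficients of degree one are unchanged
      (∀ (c : CoeffArray d) (k l : ℤ) (m : Fin d → ℕ),
        p * k + q * l = 0 → ∑ i, m i = 1 → T c k l m = c k l m) ∧
      ∀ (U : Set (Param d)) (F : Param d → Plane → ℝ),
        IsOpen U → (0 : Param d) ∈ U →
        ContDiffOn ℝ ∞ (fun w : Param d × Plane => F w.1 w.2) (U ×ˢ Set.univ) →
        (∀ μ ∈ U, IsBiperiodic (F μ)) →
        (∀ z, F 0 z = 0) →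
        -- the generators `g m`, their flows `φ`, the normal form terms `a m`, the remainder `R`
        ∃ (g : (Fin d → ℕ) → Plane → ℝ)
          (φ : ℕ → Param d → ℝ → Plane → Plane)
          (a : (Fin d → ℕ) → Plane → ℝ)
          (R : Param d → Plane → ℝ)
          (V : Set (Param d)) (C : ℝ),
          (∀ m, ContDiff ℝ ∞ (g m) ∧ IsBiperiodic (g m)) ∧
          (∀ j ∈ Finset.Icc 1 n, ∀ μ,
            IsFlowOf (shearField (homPart g j μ)) (φ j μ)) ∧
          (∀ j ∈ Finset.Icc 1 n, IsNearIdentity j (fun μ => φ j μ 1)) ∧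
          (∀ m, ContDiff ℝ ∞ (a m) ∧ IsBiperiodic (a m)) ∧
          (∀ m : Fin d → ℕ, ∑ i, m i ∈ Finset.Icc 1 n → ∀ z : Plane,
            HasSum (fun r : {kl : ℤ × ℤ // p * kl.1 + q * kl.2 = 0} =>
                T (fourierTaylorCoeff F) r.1.1 r.1.2 m * mode r.1.1 r.1.2 z)
              ((a m z : ℝ) : ℂ)) ∧
          IsOpen V ∧ (0 : Param d) ∈ V ∧ V ⊆ U ∧
          ContDiffOn ℝ ∞ (fun w : Param d × Plane => R w.1 w.2) (V ×ˢ Set.univ) ∧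
          (∀ μ ∈ V, IsBiperiodic (R μ)) ∧
          (∀ μ ∈ V, ∀ z, |R μ z| ≤ C * ‖μ‖ ^ (n + 1)) ∧
          (∀ μ ∈ V,
            transformed (fun j μ => φ j μ 1) (oscillatorField p q F) n μ =
              oscillatorField p q
                (fun μ z => (∑ j ∈ Finset.Icc 1 n, homPart a j μ z) + R μ z) μ) := by
  choose T hT using exists_normal_form_coeff (d := d) n p q hq
  refine ⟨T, fun c => (hT c).1, fun U F hU h0 hF hper hz => ?_⟩
  obtain ⟨G, hG, hGF⟩ := exists_ord_one_extension hU h0 hF hper hz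
  -- The coefficients depend only on the germ of the family at `μ = 0`, so the extension has those
  -- of `F`.
  have hc : fourierTaylorCoeff G = fourierTaylorCoeff F := by
    have h : ∀ z m, taylorCoeff (fun μ => G μ z) m = taylorCoeff (fun μ => F μ z) m :=
      fun z m => taylorCoeff_congr (hGF.mono fun μ hμ => congrFun hμ z) m
    funext k l m
    simp only [fourierTaylorCoeff, h]
  obtain ⟨g, a, R, hg, ha, hsum, hR, htr⟩ := (hT (fourierTaylorCoeff F)).2 G hG hc
  obtain ⟨C, hC⟩ := hR.exists_bound
  obtain ⟨V, hV, hVo, hV0⟩ := eventually_nhds_iff.1 ((hGF.and hC).and (hU.mem_nhds h0))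
  have hflow : ∀ j, IsShearFlow (homPart g j) (shearFlow (homPart g j)) := fun j =>
    (Ord.of_homPart j hg).smoothPer.isShearFlow
  refine ⟨g, fun j μ t z => generatorFlow g j μ t z, a, R, V, C, hg, fun j _ μ => (hflow j).isFlowOf μ,
    fun j _ => (hflow j).isNearIdentity (Ord.of_homPart j hg).smoothPer j
      ((hflow j).ord_displacement (Ord.of_homPart j hg)).exists_bound,
    ha, hsum, hVo, hV0, fun μ hμ => (hV μ hμ).2, hR.smoothPer.smooth.contDiffOn,
    fun μ _ => hR.smoothPer.per μ, fun μ hμ => (hV μ hμ).1.2, fun μ hμ => ?_⟩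
  refine (transformed_congr_field ?_ n).trans (htr μ)
  funext z
  simp only [oscillatorField, (hV μ hμ).1.1]
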